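/- Let $n,m\ge 1$. Write $B_k=\{x\in\mathbb R^n:|x|\le 2^k\}$, $C_k=B_k\setminus B_{k-1}$, $\chi_k=\chi_{C_k}$ for $k\in\mathbb Z$; $q_-=\operatorname{ess\,inf} q$, $q_+=\operatorname{ess\,sup} q$; and $\|M\|=(\sum_{j,k}|M_{jk}|^2)^{1/2}$ for an $n\times n$ matrix $M$. **Function spaces.** For a measurable exponent $p(\cdot)$ with values in $(0,\infty]$ and $\Omega_\infty=\{p=\infty\}$ put $F_p(f)=\int_{\mathbb R^n\setminus\Omega_\infty}|f(x)|^{p(x)}dx+\|f\|_{L^\infty(\Omega_\infty)}$, $\|f\|_{L^{p(\cdot)}}=\inf\{\eta>0:F_p(f/\eta)\le 1\}$ and $\|f\|_{L^{p(\cdot)}_\omega}=\|f\omega\|_{L^{p(\cdot)}}$. Let $\mathcal P_b$ be the set of measurable $q:\mathbb R^n\to\mathbb R$ with $1<q_-\le q(x)\le q_+<\infty$ for all $x$, and $\mathcal P_\infty$ the set of measurable $r:\mathbb R^n\to[1,\infty]$ such that $r_\infty=\lim_{|x|\to\infty}r(x)$ exists in $[1,\infty]$. Let $\mathbf C_0^{\log}$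 be the set of $\alpha:\mathbb R^n\to\mathbb R$ with $|\alpha(x)-\alpha(0)|\le C/\log(e+1/|x|)$ for all $x$ and some $C$, and $\mathbf C_\infty^{\log}$ the set of those with $|\alpha(x)-\alpha_\infty|\le C/\log(e+|x|)$ for all $x$ and some $C$ and $\alpha_\infty\in\mathbb R$. The weighted variable-exponent Morrey–Herz space $M\dot K^{\alpha(\cdot),\lambda}_{p,q(\cdot),\omega}$ consists of the measurable $f:\mathbb R^n\to\mathbb C$ in $L^{q(\cdot)}_{\rm loc}(\mathbb R^n\setminus\{0\})$ with $$\|f\|_{M\dot K^{\alpha(\cdot),\lambda}_{p,q(\cdot),\omega}}=\sup_{k_0\in\mathbb Z}2^{-k_0\lambda}\Big(\sum_{k=-\infty}^{k_0}\|2^{k\alpha(\cdot)}f\chi_k\|^p_{L^{q(\cdot)}_\omega}\Big)^{1/p}<\infty .$$ For $0<\beta\le 1$, ${\rm Lip}^\beta$ is the set of $b:\mathbb R^n\to\mathbb C$ with $\sup_{x\ne y}|b(x)-b(y)|/|x-y|^\beta<\infty$. **Data.** Let $\Phi:\mathbb R^n\to[0,\infty)$ be measurable, and let $A_1,\dots,A_m$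 be measurable functions from $\mathbb R^n$ to the real $n\times n$ matrices, with $A_i(t)$ invertible for a.e. $t\in{\rm supp}(\Phi)$, where ${\rm supp}(\Phi)=\{\Phi\ne 0\}$. Let $\zeta>0$ and, for $i=1,\dots,m$, let $\gamma_i\in\mathbb R$, $\lambda_i>0$, $p_i\in(0,\infty)$, $0<\beta_i\le1$, $q_i\in\mathcal P_b$, $r_i\in\mathcal P_\infty$, $\alpha_i\in L^\infty\cap\mathbf C_0^{\log}\cap\mathbf C_\infty^{\log}$ with value $\alpha_{i\infty}$ at infinity, and $b_i\in{\rm Lip}^{\beta_i}$; let $p\in(0,\infty)$. With $1/\infty=0$, define $$\lambda=\sum_i\lambda_i,\quad \frac1{q(\cdot)}=\sum_i\frac1{q_i(\cdot)}+\sum_i\frac1{r_i(\cdot)},\quad \gamma(\cdot)=\sum_i\gamma_i+\sum_i\frac{\gamma_i}{r_i(\cdot)},$$ $$\alpha^*(\cdot)=\sum_i\alpha_i(\cdot)-\sum_i\beta_i-\sum_i\frac{\gamma_i+n}{r_i(\cdot)},\qquad \omega_i(x)=|x|^{\gamma_i},\quad \omega(x)=|x|^{\gamma(x)},$$ and assume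 $q\in\mathcal P_b$ and $\alpha^*\in L^\infty\cap\mathbf C_0^{\log}\cap\mathbf C_\infty^{\log}$. The commutator of the multilinear Hausdorff operator is $$H^{\vec b}_{\Phi,\vec A}(\vec f)(x)=\int_{\mathbb R^n}\frac{\Phi(t)}{|t|^n}\prod_{i=1}^m f_i(A_i(t)x)\prod_{i=1}^m\big(b_i(x)-b_i(A_i(t)x)\big)\,dt .$$ **Hypotheses.** Let $\dfrac1{\vartheta_i(t,\cdot)}=\dfrac1{q_i(A_i^{-1}(t)\cdot)}-\dfrac1{\zeta q_i(\cdot)}$. Assume: 1. for every $i$ and a.e. $t\in{\rm supp}(\Phi)$: $q_i(A_i^{-1}(t)x)\le\zeta q_i(x)$ for a.e. $x$, and $\|1\|_{L^{\vartheta_i(t,\cdot)}}<\infty$; 2. $\alpha_i(0)-\alpha_{i\infty}\ge0$ for every $i$; 3. one of the following holds: (a) $\gamma_i>-n$, $r_i(0)=r_{i+}$ and $r_{i\infty}=r_{i-}$ for all $i$; (b) $\gamma_i<-n$, $r_i(0)=r_{i-}$ and $r_{i\infty}=r_{i+}$ for all $i$; (c) $\gamma_i=-n$ for all $i$; 4.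 $\displaystyle \mathcal C_1=\int_{\mathbb R^n}\frac{\Phi(t)}{|t|^n}\prod_{i=1}^m c_{A_i,q_i,\gamma_i}(t)\,\|I_n-A_i(t)\|^{\beta_i}\,\|1\|_{L^{\vartheta_i(t,\cdot)}}\,\phi_{A_i,\lambda_i}(t)\,dt<\infty,$ where $$c_{A_i,q_i,\gamma_i}(t)=\max\{\|A_i(t)\|^{-\gamma_i},\|A_i^{-1}(t)\|^{\gamma_i}\}\,\max\{|\det A_i^{-1}(t)|^{1/q_{i+}},|\det A_i^{-1}(t)|^{1/q_{i-}}\},$$ $$\phi_{A_i,\lambda_i}(t)=\max\{\|A_i(t)\|^{\lambda_i-\alpha_i(0)},\|A_i(t)\|^{\lambda_i-\alpha_{i\infty}}\}\,\max\Big\{\sum_{s=\Theta_n^*-1}^{0}2^{s(\lambda_i-\alpha_i(0))},\sum_{s=\Theta_n^*-1}^{0}2^{s(\lambda_i-\alpha_{i\infty})}\Big\},$$ and $\Theta_n^*=\Theta_n^*(t)$ is the greatest integer with $\max_{1\le i\le m}\|A_i(t)\|\,\|A_i^{-1}(t)\|<2^{-\Theta_n^*}$. **Conclusion.** $H^{\vec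 b}_{\Phi,\vec A}$ is a bounded operator from $M\dot K^{\alpha_1(\cdot),\lambda_1}_{p_1,\zeta q_1(\cdot),\omega_1}\times\cdots\times M\dot K^{\alpha_m(\cdot),\lambda_m}_{p_m,\zeta q_m(\cdot),\omega_m}$ to $M\dot K^{\alpha^*(\cdot),\lambda}_{p,\zeta q(\cdot),\omega}$: there is a constant $C<\infty$ such that for all $f_i\in M\dot K^{\alpha_i(\cdot),\lambda_i}_{p_i,\zeta q_i(\cdot),\omega_i}$ the integral defining $H^{\vec b}_{\Phi,\vec A}(\vec f)(x)$ converges absolutely for a.e. $x$, $H^{\vec b}_{\Phi,\vec A}(\vec f)$ belongs to the target space, and $$\big\|H^{\vec b}_{\Phi,\vec A}(\vec f)\big\|_{M\dot K^{\alpha^*(\cdot),\lambda}_{p,\zeta q(\cdot),\omega}}\le C\prod_{i=1}^m\|f_i\|_{M\dot K^{\alpha_i(\cdot),\lambda_i}_{p_i,\zeta q_i(\cdot),\omega_i}} .$$ -/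

import Mathlib

open MeasureTheory Filter Topology
open scoped ENNReal NNReal

noncomputable section

namespace HausdorffCommutator

/-- Euclidean space `ℝⁿ` with the Euclidean norm. -/
abbrev Rn (n : ℕ) := EuclideanSpace ℝ (Fin n)

variable {n m : ℕ}

/-! ### Variable exponent Lebesgue spaces -/

/-- The modular
`F_p(f) = ∫_{p < ∞} |f(x)|^{p(x)} dx + ‖f‖_{L^∞({p = ∞})}` with values in `[0, ∞]`. -/
def modular (p : Rn n → ℝ≥0∞) (f : Rn n → ℂ) : ℝ≥0∞ :=
  (∫⁻ x in {x | p x ≠ ⊤}, ‖f x‖ₑ ^ (p x).toReal) +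
    eLpNorm f ⊤ (volume.restrict {x | p x = ⊤})

/-- The Luxemburg norm `‖f‖_{L^{p(·)}} = inf {η > 0 : F_p(f / η) ≤ 1}`, with the value `∞` when
there is no such `η`. -/
def lpVarNorm (p : Rn n → ℝ≥0∞) (f : Rn n → ℂ) : ℝ≥0∞ :=
  ⨅ η : {η : ℝ // 0 < η ∧ modular p (fun x => f x / (η : ℂ)) ≤ 1}, ENNReal.ofReal η.1

/-- The weighted norm `‖f‖_{L^{p(·)}_ω} = ‖f ω‖_{L^{p(·)}}`. -/
def lpVarNormW (p : Rn n → ℝ≥0∞) (ω : Rn n → ℝ) (f : Rn n → ℂ) : ℝ≥0∞ :=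
  lpVarNorm p (fun x => f x * (ω x : ℂ))

/-- `f ∈ L^{p(·)}_loc(ℝⁿ ∖ {0})`. -/
def MemLpVarLocPunctured (p : Rn n → ℝ≥0∞) (f : Rn n → ℂ) : Prop :=
  AEStronglyMeasurable f volume ∧
    ∀ K : Set (Rn n), IsCompact K → (0 : Rn n) ∉ K → lpVarNorm p (K.indicator f) < ⊤

/-- `q₋`, the essential infimum of a real exponent. -/
def expInf (q : Rn n → ℝ) : ℝ := essInf q volume

/-- `q₊`, the essential supremum of a real exponent. -/
def expSup (q : Rn n → ℝ) : ℝ := essSup q volume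

/-- The class `𝒫_b(ℝⁿ)`: measurable exponents with `1 < q₋ ≤ q(x) ≤ q₊ < ∞` for all `x`. -/
def ClassPb (q : Rn n → ℝ) : Prop :=
  AEMeasurable q volume ∧ 1 < expInf q ∧ ∀ x, expInf q ≤ q x ∧ q x ≤ expSup q

/-- The class `𝒫_∞(ℝⁿ)`, with the limit exposed: `r` is a measurable function with values in
`[1, ∞]` and `r(x) → r_∞` as `|x| → ∞`. -/
def ClassPinfty (r : Rn n → ℝ≥0∞) (rinf : ℝ≥0∞) : Prop :=
  AEMeasurable r volume ∧ (∀ x, 1 ≤ r x) ∧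
    Tendsto r (Bornology.cobounded (Rn n)) (𝓝 rinf)

/-! ### Log-Hölder continuity at the origin and at infinity -/

/-- `α ∈ C₀^log(ℝⁿ)`. -/
def LogHolderAtZero (α : Rn n → ℝ) : Prop :=
  ∃ C : ℝ, ∀ x, |α x - α 0| ≤ C / Real.log (Real.exp 1 + 1 / ‖x‖)

/-- `α ∈ C_∞^log(ℝⁿ)` with the value `αinf` at infinity. -/
def LogHolderAtInfty (α : Rn n → ℝ) (αinf : ℝ) : Prop :=
  ∃ C : ℝ, ∀ x, |α x - αinf| ≤ C / Real.log (Real.exp 1 + ‖x‖)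

/-! ### Weighted Morrey–Herz spaces with variable exponent -/

/-- The dyadic annulus `C_k = B_k ∖ B_{k-1}`, where `B_k = {|x| ≤ 2^k}`. -/
def annulus (n : ℕ) (k : ℤ) : Set (Rn n) :=
  Metric.closedBall 0 ((2 : ℝ) ^ k) \ Metric.closedBall 0 ((2 : ℝ) ^ (k - 1))

/-- `‖f‖ = sup_{k₀} 2^{-k₀ λ} (∑_{k ≤ k₀} ‖2^{k α(·)} f χ_k‖_{L^{q(·)}_ω}^p)^{1/p}`. -/
def morreyHerzNorm (α : Rn n → ℝ) (lam p : ℝ) (q ω : Rn n → ℝ) (f : Rn n → ℂ) : ℝ≥0∞ :=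
  ⨆ k₀ : ℤ, ENNReal.ofReal ((2 : ℝ) ^ (-(k₀ : ℝ) * lam)) *
    (∑' k : Set.Iic k₀,
      lpVarNormW (fun x => ENNReal.ofReal (q x)) ω
        (fun x => (((2 : ℝ) ^ ((k.1 : ℝ) * α x) : ℝ) : ℂ) * (annulus n k.1).indicator f x) ^ p)
      ^ (1 / p)

/-- Membership in the weighted Morrey–Herz space `MK^{α(·),λ}_{p,q(·),ω}`. -/
def MemMorreyHerz (α : Rn n → ℝ) (lam p : ℝ) (q ω : Rn n → ℝ) (f : Rn n → ℂ) : Prop :=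
  MemLpVarLocPunctured (fun x => ENNReal.ofReal (q x)) f ∧ morreyHerzNorm α lam p q ω f < ⊤

/-! ### The commutator of the multilinear Hausdorff operator -/

/-- The matrix norm `(∑ |a_{ij}|²)^{1/2}`. -/
def matNorm (M : Matrix (Fin n) (Fin n) ℝ) : ℝ :=
  Real.sqrt (∑ j, ∑ k, |M j k| ^ 2)

/-- The matrix-vector product on Euclidean space. -/
def act (M : Matrix (Fin n) (Fin n) ℝ) (x : Rn n) : Rn n :=
  WithLp.toLp 2 (M.mulVec x.ofLp)

/-- The integrand, in `t`, of the commutator. -/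
def commutatorIntegrand (Φ : Rn n → ℝ) (A : Fin m → Rn n → Matrix (Fin n) (Fin n) ℝ)
    (b f : Fin m → Rn n → ℂ) (x t : Rn n) : ℂ :=
  ((Φ t / ‖t‖ ^ n : ℝ) : ℂ) * (∏ i, f i (act (A i t) x)) * ∏ i, (b i x - b i (act (A i t) x))

/-- The Coifman–Rochberg–Weiss type commutator `H^b_{Φ,A}(f)(x)`. -/
def commutator (Φ : Rn n → ℝ) (A : Fin m → Rn n → Matrix (Fin n) (Fin n) ℝ)
    (b f : Fin m → Rn n → ℂ) (x : Rn n) : ℂ :=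
  ∫ t, commutatorIntegrand Φ A b f x t

/-! ### The exponents and weight of the target space

The exponents `r_i` may take the value `∞`, where `1 / r_i = 0`. -/

/-- `1 / r` as a real number, for `r ∈ [1, ∞]`. -/
def recip (r : ℝ≥0∞) : ℝ := (r⁻¹).toReal

/-- `q(·)`, given by `1 / q = ∑ 1 / q_i + ∑ 1 / r_i`. -/
def targetExponent (q : Fin m → Rn n → ℝ) (r : Fin m → Rn n → ℝ≥0∞) (x : Rn n) : ℝ :=
  1 / (∑ i, 1 / q i x + ∑ i, recip (r i x))

/-- `γ(·) = ∑ γ_i + ∑ γ_i / r_i(·)`. -/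
def targetGamma (γ : Fin m → ℝ) (r : Fin m → Rn n → ℝ≥0∞) (x : Rn n) : ℝ :=
  ∑ i, γ i + ∑ i, γ i * recip (r i x)

/-- `α^*(·) = ∑ α_i(·) - ∑ β_i - ∑ (γ_i + n) / r_i(·)`. -/
def targetAlpha (α : Fin m → Rn n → ℝ) (β : Fin m → ℝ≥0) (γ : Fin m → ℝ)
    (r : Fin m → Rn n → ℝ≥0∞) (x : Rn n) : ℝ :=
  ∑ i, α i x - ∑ i, (β i : ℝ) - ∑ i, (γ i + n) * recip (r i x)

/-! ### The quantities in the integral condition -/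

/-- `ϑ(·)` for one matrix `M = A_i(t)`: `1 / ϑ(x) = 1 / q(M⁻¹ x) - 1 / (ζ q(x))`
(so `ϑ(x) = ∞` where the right-hand side vanishes). -/
def thetaExp (ζ : ℝ) (q : Rn n → ℝ) (M : Matrix (Fin n) (Fin n) ℝ) (x : Rn n) : ℝ≥0∞ :=
  (ENNReal.ofReal (1 / q (act M⁻¹ x) - 1 / (ζ * q x)))⁻¹

/-- `‖1‖_{L^{ϑ(·)}}` for one matrix. -/
def thetaNorm (ζ : ℝ) (q : Rn n → ℝ) (M : Matrix (Fin n) (Fin n) ℝ) : ℝ≥0∞ :=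
  lpVarNorm (thetaExp ζ q M) (fun _ => 1)

/-- `c_{M,q,γ} = max{‖M‖^{-γ}, ‖M⁻¹‖^γ} · max{|det M⁻¹|^{1/q₊}, |det M⁻¹|^{1/q₋}}`. -/
def cConst (M : Matrix (Fin n) (Fin n) ℝ) (q : Rn n → ℝ) (γ : ℝ) : ℝ :=
  max (matNorm M ^ (-γ)) (matNorm M⁻¹ ^ γ) *
    max (|M⁻¹.det| ^ (1 / expSup q)) (|M⁻¹.det| ^ (1 / expInf q))

/-- `Θ_n^*`: the greatest integer `θ` with `max_i ‖M_i‖ ‖M_i⁻¹‖ < 2^{-θ}`. -/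
def thetaStar (M : Fin m → Matrix (Fin n) (Fin n) ℝ) : ℤ :=
  sSup {θ : ℤ | ∀ i, matNorm (M i) * matNorm (M i)⁻¹ < (2 : ℝ) ^ (-θ)}

/-- `φ` for one matrix `M`, with `θ = Θ_n^*`, `a₀ = α(0)` and `a_∞ = α_∞`. -/
def phiConst (M : Matrix (Fin n) (Fin n) ℝ) (θ : ℤ) (lam a₀ ainf : ℝ) : ℝ :=
  max (matNorm M ^ (lam - a₀)) (matNorm M ^ (lam - ainf)) *
    max (∑ s ∈ Finset.Icc (θ - 1) 0, (2 : ℝ) ^ ((s : ℝ) * (lam - a₀)))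
      (∑ s ∈ Finset.Icc (θ - 1) 0, (2 : ℝ) ^ ((s : ℝ) * (lam - ainf)))

/-- The integral constant `𝒞₁ ∈ [0, ∞]`. -/
def constC1 (Φ : Rn n → ℝ) (A : Fin m → Rn n → Matrix (Fin n) (Fin n) ℝ) (ζ : ℝ)
    (q : Fin m → Rn n → ℝ) (γ : Fin m → ℝ) (β : Fin m → ℝ≥0) (lam : Fin m → ℝ)
    (α : Fin m → Rn n → ℝ) (αinf : Fin m → ℝ) : ℝ≥0∞ :=
  ∫⁻ t, ENNReal.ofReal (Φ t / ‖t‖ ^ n) *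
    ∏ i, (ENNReal.ofReal (cConst (A i t) (q i) (γ i)) *
      ENNReal.ofReal (matNorm (1 - A i t) ^ (β i : ℝ)) *
      thetaNorm ζ (q i) (A i t) *
      ENNReal.ofReal
        (phiConst (A i t) (thetaStar (fun j => A j t)) (lam i) (α i 0) (αinf i)))

end HausdorffCommutator

end

open HausdorffCommutator

/-!
Boundedness of commutators of the multilinear Hausdorff operator on weighted Morrey–Herz spaces with
variable exponents.

The operator is an integral over `t` of products of the dilates `f_i(A_i(t) x)`, so the proof
estimates the integrand on each dyadic annulus `C_k` for fixed `t` and then integrates the norms.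

*The scaling parameter.* If `Φ` vanishes almost everywhere, the operator is zero. Otherwise the
hypotheses on a single invertible matrix force `ζ = 1` (`eq_one_of_thetaNorm_lt_top`): for `ζ < 1`
the inequality `q(M⁻¹ x) ≤ ζ q(x)` can be iterated until `q` falls below one, and for `ζ > 1` the
finiteness of `‖1‖_{L^ϑ}` makes `1 / q ∘ M⁻¹` at most `ζ⁻¹ / q` up to a small error off a set of
finite measure, which contradicts the boundedness of `q` after finitely many steps.

*One function and one matrix.* A change of variables replaces the exponent `q` by `q ∘ M⁻¹`
(`luxNorm_comp_act_le`), and Hölder's inequality for `1 / q(M⁻¹ x) = 1 / q(x) + 1 / ϑ(x)` returns to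
`q` (`luxNorm_act_inv_exponent_le`). The image of `C_k` under `M` lies in a block of consecutive
annuli whose length depends only on `‖M‖ ‖M⁻¹‖` (`exists_act_mem_annulus`). On `C_l` the
log-Hölder conditions replace `α` by its value at the origin or at infinity, and each term of the
Morrey–Herz norm is at most `2^{lλ}` times the norm. The resulting geometric sum is `phiConst`
(`luxNorm_annulus_comp_act_le`).

*Fixed `t`.* On `C_k` the powers of `2^k` coming from `α^*`, from the Lipschitz bounds for the `b_i`
and from the variable part of the weight cancel except for `∏ 2^{-kn / r_i(x)}`
(`target_weight_le`). Since `2^{-kn} |C_k|` does not depend on `k`, Hölder's inequality for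
`1 / q = ∑ 1 / q_i + ∑ 1 / r_i` gives a bound uniform in `k`
(`exists_luxNorm_commutatorIntegrand_le`).

*Integration over `t`.* Minkowski's integral inequality for the Luxemburg norm
(`luxNorm_lintegral_le`) is Jensen's inequality at each point, applied after normalizing the sections
by their norms, followed by Tonelli's theorem. It gives the bound `C 2^{kλ}` on `C_k`, and as `λ > 0`
the sum over `k ≤ k₀` is a geometric series (`morreyHerzNorm_le_of_forall`).
-/

namespace HausdorffCommutator

/-! ### Luxemburg norms of extended nonnegative functions -/

section Luxemburg

variable {X T : Type*} [MeasurableSpace X] [MeasurableSpace T]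

/-- The modular `∫ g(x)^{q(x)} dν(x)` of a function with values in `[0, ∞]`, for a finite
exponent. -/
noncomputable def emodular (ν : Measure X) (q : X → ℝ) (g : X → ℝ≥0∞) : ℝ≥0∞ :=
  ∫⁻ x, g x ^ q x ∂ν

/-- The Luxemburg norm of a function with values in `[0, ∞]`, for a finite exponent. It is `∞` when
no `η` is admissible. -/
noncomputable def luxNorm (ν : Measure X) (q : X → ℝ) (g : X → ℝ≥0∞) : ℝ≥0∞ :=
  ⨅ η : {η : ℝ // 0 < η ∧ emodular ν q (fun x => g x / ENNReal.ofReal η) ≤ 1}, ENNReal.ofReal η.1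

variable {ν : Measure X} {q : X → ℝ} {g h : X → ℝ≥0∞}

lemma luxNorm_le {η : ℝ} (hη : 0 < η)
    (h : emodular ν q (fun x => g x / ENNReal.ofReal η) ≤ 1) :
    luxNorm ν q g ≤ ENNReal.ofReal η :=
  iInf_le (fun η : {η : ℝ // 0 < η ∧ emodular ν q (fun x => g x / ENNReal.ofReal η) ≤ 1} =>
    ENNReal.ofReal η.1) ⟨η, hη, h⟩

lemma emodular_mono_ae (hq : ∀ x, 0 ≤ q x) (hgh : ∀ᵐ x ∂ν, g x ≤ h x) :
    emodular ν q g ≤ emodular ν q h := by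
  refine lintegral_mono_ae ?_
  filter_upwards [hgh] with x hx
  exact ENNReal.rpow_le_rpow hx (hq x)

lemma emodular_le_one_of_luxNorm_lt (hq : ∀ x, 0 ≤ q x) {η : ℝ}
    (h : luxNorm ν q g < ENNReal.ofReal η) :
    emodular ν q (fun x => g x / ENNReal.ofReal η) ≤ 1 := by
  obtain ⟨⟨η', h0, h1⟩, h2⟩ := iInf_lt_iff.1 h
  refine (emodular_mono_ae hq (ae_of_all _ fun x => ?_)).trans h1
  exact ENNReal.div_le_div_left h2.le _

/-- A strict bound on the norm bounds the modular, also for scaling factors in `[0, ∞]`. -/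
lemma emodular_div_le_one_of_luxNorm_lt (hq : ∀ x, 0 ≤ q x) {η : ℝ≥0∞} (hη : η ≠ ⊤)
    (h : luxNorm ν q g < η) : emodular ν q (fun x => g x / η) ≤ 1 := by
  have := emodular_le_one_of_luxNorm_lt (η := η.toReal) (g := g) (ν := ν) hq
  rw [ENNReal.ofReal_toReal hη] at this
  exact this h

lemma luxNorm_le_of_forall_gt {c : ℝ≥0∞}
    (h : ∀ η : ℝ, 0 < η → c < ENNReal.ofReal η → luxNorm ν q g ≤ ENNReal.ofReal η) :
    luxNorm ν q g ≤ c := by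
  refine le_of_forall_gt_imp_ge_of_dense fun a ha => ?_
  by_cases hat : a = ⊤
  · simp [hat]
  have := h a.toReal (ENNReal.toReal_pos (ne_bot_of_gt ha) hat)
  rw [ENNReal.ofReal_toReal hat] at this
  exact this ha

lemma luxNorm_mono_ae (hq : ∀ x, 0 ≤ q x) (hgh : ∀ᵐ x ∂ν, g x ≤ h x) :
    luxNorm ν q g ≤ luxNorm ν q h := by
  refine luxNorm_le_of_forall_gt fun η hη hlt => luxNorm_le hη ?_
  refine (emodular_mono_ae hq ?_).trans (emodular_le_one_of_luxNorm_lt hq hlt)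
  filter_upwards [hgh] with x hx
  exact ENNReal.div_le_div_right hx _

lemma luxNorm_congr_ae (hgh : g =ᵐ[ν] h) : luxNorm ν q g = luxNorm ν q h := by
  have : ∀ η : ℝ, emodular ν q (fun x => g x / ENNReal.ofReal η) =
      emodular ν q (fun x => h x / ENNReal.ofReal η) := by
    intro η
    refine lintegral_congr_ae ?_
    filter_upwards [hgh] with x hx
    rw [hx]
  exact le_antisymm (le_iInf fun η => luxNorm_le η.2.1 ((this η).trans_le η.2.2))
    (le_iInf fun η => luxNorm_le η.2.1 ((this η).symm.trans_le η.2.2))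

lemma luxNorm_congr_exponent {q' : X → ℝ} (hq : q =ᵐ[ν] q') :
    luxNorm ν q g = luxNorm ν q' g := by
  have : ∀ η : ℝ, emodular ν q (fun x => g x / ENNReal.ofReal η) =
      emodular ν q' (fun x => g x / ENNReal.ofReal η) := by
    intro η
    refine lintegral_congr_ae ?_
    filter_upwards [hq] with x hx
    rw [hx]
  exact le_antisymm (le_iInf fun η => luxNorm_le η.2.1 ((this η).trans_le η.2.2))
    (le_iInf fun η => luxNorm_le η.2.1 ((this η).symm.trans_le η.2.2))

lemma luxNorm_zero (hq : ∀ x, 0 < q x) : luxNorm ν q (fun _ => 0) = 0 := by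
  refine le_antisymm (luxNorm_le_of_forall_gt fun η hη _ => luxNorm_le hη ?_) zero_le
  simp [emodular, ENNReal.zero_rpow_of_pos (hq _)]

/-- By convexity, a modular bounded by `K ≥ 1` gives a norm bounded by `K`. -/
lemma luxNorm_le_mul_of_emodular_le (hq : ∀ x, 1 ≤ q x) {η K : ℝ} (hη : 0 < η) (hK : 1 ≤ K)
    (h : emodular ν q (fun x => g x / ENNReal.ofReal η) ≤ ENNReal.ofReal K) :
    luxNorm ν q g ≤ ENNReal.ofReal (K * η) := by
  have hK0 : 0 < K := by linarith
  have hKe : ENNReal.ofReal K ≠ 0 := by simpa using hK0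
  refine luxNorm_le (by positivity) ?_
  have key : ∀ x, (g x / ENNReal.ofReal (K * η)) ^ q x ≤
      (ENNReal.ofReal K)⁻¹ * (g x / ENNReal.ofReal η) ^ q x := by
    intro x
    have : g x / ENNReal.ofReal (K * η) = (ENNReal.ofReal K)⁻¹ * (g x / ENNReal.ofReal η) := by
      rw [ENNReal.ofReal_mul hK0.le, ENNReal.div_eq_inv_mul, ENNReal.div_eq_inv_mul,
        ENNReal.mul_inv (Or.inl hKe) (Or.inl ENNReal.ofReal_ne_top), mul_assoc]
    rw [this, ENNReal.mul_rpow_of_nonneg _ _ (by linarith [hq x])]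
    gcongr
    refine (ENNReal.rpow_le_rpow_of_exponent_ge ?_ (hq x)).trans (by rw [ENNReal.rpow_one])
    rw [ENNReal.inv_le_one]
    simpa using hK
  calc emodular ν q (fun x => g x / ENNReal.ofReal (K * η))
      ≤ ∫⁻ x, (ENNReal.ofReal K)⁻¹ * (g x / ENNReal.ofReal η) ^ q x ∂ν := lintegral_mono key
    _ = (ENNReal.ofReal K)⁻¹ * emodular ν q (fun x => g x / ENNReal.ofReal η) :=
        lintegral_const_mul' _ _ (by simpa using hK0)
    _ ≤ (ENNReal.ofReal K)⁻¹ * ENNReal.ofReal K := by gcongr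
    _ = 1 := ENNReal.inv_mul_cancel hKe ENNReal.ofReal_ne_top

lemma luxNorm_const_mul_le (hq : ∀ x, 0 < q x) {c : ℝ≥0∞} (hc : c ≠ ⊤) :
    luxNorm ν q (fun x => c * g x) ≤ c * luxNorm ν q g := by
  rcases eq_or_ne c 0 with rfl | hc0
  · simp [luxNorm_zero hq]
  have hcpos : 0 < c.toReal := ENNReal.toReal_pos hc0 hc
  rw [luxNorm.eq_def ν q g, ENNReal.mul_iInf_of_ne hc0 hc]
  refine le_iInf fun ⟨η, hη, h⟩ => ?_
  have e : c * ENNReal.ofReal η = ENNReal.ofReal (c.toReal * η) := by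
    rw [ENNReal.ofReal_mul hcpos.le, ENNReal.ofReal_toReal hc]
  rw [e]
  refine luxNorm_le (by positivity) ?_
  convert h using 3 with x
  rw [← e, ENNReal.mul_div_mul_left _ _ hc0 hc]

lemma ae_lt_top_of_luxNorm_lt_top (hq : ∀ x, 0 < q x) (hqm : AEMeasurable q ν)
    (hg : AEMeasurable g ν) (h : luxNorm ν q g < ⊤) : ∀ᵐ x ∂ν, g x < ⊤ := by
  obtain ⟨⟨η, hη, h1⟩, -⟩ := iInf_lt_iff.1 h
  have := ae_lt_top' (f := fun x => (g x / ENNReal.ofReal η) ^ q x) (μ := ν)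
    ((hg.div_const _).pow hqm) (ne_top_of_le_ne_top ENNReal.one_ne_top h1)
  filter_upwards [this] with x hx
  by_contra hcon
  rw [not_lt, top_le_iff] at hcon
  simp [hcon, ENNReal.top_div_of_ne_top, ENNReal.top_rpow_of_pos (hq x)] at hx

/-- The Luxemburg norm of the sections of a jointly measurable function is measurable: the infimum
may be taken over rational numbers. -/
lemma measurable_luxNorm [SFinite ν] (hq : ∀ x, 0 ≤ q x) (hqm : Measurable q) {F : T → X → ℝ≥0∞}
    (hF : Measurable (Function.uncurry F)) : Measurable fun t => luxNorm ν q (F t) := by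
  have hmod : ∀ η : ℝ, Measurable fun t => emodular ν q (fun x => F t x / ENNReal.ofReal η) := by
    intro η
    refine Measurable.lintegral_prod_right (f := fun t x => (F t x / ENNReal.ofReal η) ^ q x) ?_
    exact (hF.div_const _).pow (hqm.comp measurable_snd)
  refine measurable_of_Iio fun c => ?_
  have : (fun t => luxNorm ν q (F t)) ⁻¹' Set.Iio c =
      ⋃ r : {r : ℚ // 0 < r ∧ ENNReal.ofReal (r : ℝ) < c},
        {t | emodular ν q (fun x => F t x / ENNReal.ofReal (r.1 : ℝ)) ≤ 1} := by
    ext t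
    simp only [Set.mem_preimage, Set.mem_Iio, Set.mem_iUnion, Set.mem_ofPred_eq]
    constructor
    · intro h
      obtain ⟨r, hr0, hr1, hr2⟩ := ENNReal.lt_iff_exists_rat_btwn.1 h
      have hr1' : luxNorm ν q (F t) < ENNReal.ofReal (r : ℝ) := hr1
      have hrpos : (0 : ℝ) < r := by
        by_contra hcon
        rw [ENNReal.ofReal_of_nonpos (not_lt.1 hcon)] at hr1'
        exact not_lt_zero hr1'
      exact ⟨⟨r, by exact_mod_cast hrpos, hr2⟩, emodular_le_one_of_luxNorm_lt hq hr1'⟩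
    · rintro ⟨⟨r, hr0, hr1⟩, h⟩
      exact (luxNorm_le (by exact_mod_cast hr0) h).trans_lt hr1
  rw [this]
  exact MeasurableSet.iUnion fun r => measurableSet_le (hmod _) measurable_const

/-- Jensen's inequality for a measure of total mass at most one. -/
lemma rpow_lintegral_mul_le {μ : Measure T} {w G : T → ℝ≥0∞} (hw : Measurable w)
    (hG : Measurable G) (hw1 : ∫⁻ t, w t ∂μ ≤ 1) {p : ℝ} (hp : 1 < p) :
    (∫⁻ t, w t * G t ∂μ) ^ p ≤ ∫⁻ t, w t * G t ^ p ∂μ := by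
  have hpq := Real.HolderConjugate.conjExponent hp
  have h := ENNReal.lintegral_mul_le_Lp_mul_Lq (μ.withDensity w) hpq (f := G) (g := fun _ => 1)
    hG.aemeasurable aemeasurable_const
  have hone : ∫⁻ t, (fun _ => (1 : ℝ≥0∞)) t ^ p.conjExponent ∂(μ.withDensity w) ≤ 1 := by
    simpa using hw1
  have e1 : ∫⁻ t, (G * fun _ => (1 : ℝ≥0∞) : T → ℝ≥0∞) t ∂(μ.withDensity w) = ∫⁻ t, w t * G t ∂μ := by
    rw [lintegral_withDensity_eq_lintegral_mul _ hw (hG.mul measurable_const)]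
    simp
  have e2 : ∫⁻ t, G t ^ p ∂(μ.withDensity w) = ∫⁻ t, w t * G t ^ p ∂μ := by
    rw [lintegral_withDensity_eq_lintegral_mul _ hw (hG.pow_const p)]
    simp
  rw [e1, e2] at h
  have h' : ∫⁻ t, w t * G t ∂μ ≤ (∫⁻ t, w t * G t ^ p ∂μ) ^ (1 / p) := by
    refine h.trans (mul_le_of_le_one_right' (ENNReal.rpow_le_one hone ?_))
    exact one_div_nonneg.2 hpq.symm.nonneg
  calc _ ≤ ((∫⁻ t, w t * G t ^ p ∂μ) ^ (1 / p)) ^ p := ENNReal.rpow_le_rpow h' (by linarith)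
    _ = _ := by rw [← ENNReal.rpow_mul, one_div_mul_cancel (by linarith), ENNReal.rpow_one]

/-- Minkowski's integral inequality for the Luxemburg norm, with constant one. After normalizing
the sections by (slightly more than) their norms, it is Jensen's inequality at each point followed
by Tonelli's theorem for the modular. -/
lemma luxNorm_lintegral_le_of_measurable [SFinite ν] {μ : Measure T} [SigmaFinite μ]
    (hq : ∀ x, 1 < q x) (hqm : Measurable q) {F : T → X → ℝ≥0∞}
    (hF : Measurable (Function.uncurry F)) :
    luxNorm ν q (fun x => ∫⁻ t, F t x ∂μ) ≤ ∫⁻ t, luxNorm ν q (F t) ∂μ := by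
  have hq0 : ∀ x, 0 ≤ q x := fun x => by linarith [hq x]
  refine luxNorm_le_of_forall_gt fun η hη hlt => luxNorm_le hη ?_
  have hE0 : ENNReal.ofReal η ≠ 0 := by simpa using hη
  have hEt : ENNReal.ofReal η ≠ ⊤ := ENNReal.ofReal_ne_top
  have hNm : Measurable fun t => luxNorm ν q (F t) := measurable_luxNorm hq0 hqm hF
  obtain ⟨δ, hδ0, hδm, hδ⟩ := exists_pos_lintegral_lt_of_sigmaFinite μ (tsub_pos_of_lt hlt).ne'
  -- A measurable majorant of the norms of the sections which is positive everywhere.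
  set N : T → ℝ≥0∞ := fun t => luxNorm ν q (F t) + δ t with hN
  have hNmeas : Measurable N := hNm.add hδm.coe_nnreal_ennreal
  have hNint : ∫⁻ t, N t ∂μ ≤ ENNReal.ofReal η := by
    rw [hN, lintegral_add_left hNm]
    exact (add_le_add_right hδ.le _).trans (add_tsub_cancel_of_le hlt.le).le
  have hN0 : ∀ t, N t ≠ 0 := fun t => by simp [hN, (hδ0 t).ne']
  have hNfin : ∀ᵐ t ∂μ, N t ≠ ⊤ :=
    (ae_lt_top hNmeas (ne_top_of_le_ne_top hEt hNint)).mono fun t ht => ht.ne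
  set w : T → ℝ≥0∞ := fun t => N t / ENNReal.ofReal η with hw
  have hwm : Measurable w := hNmeas.div_const _
  have hw1 : ∫⁻ t, w t ∂μ ≤ 1 := by
    simp only [hw, ENNReal.div_eq_inv_mul]
    rw [lintegral_const_mul _ hNmeas]
    exact (mul_le_mul_right hNint _).trans (ENNReal.inv_mul_cancel hE0 hEt).le
  have hFx : ∀ x, Measurable fun t => F t x := fun x => hF.comp measurable_prodMk_right
  have hsplit : ∀ x, (∫⁻ t, F t x ∂μ) / ENNReal.ofReal η = ∫⁻ t, w t * (F t x / N t) ∂μ := by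
    intro x
    rw [ENNReal.div_eq_inv_mul, ← lintegral_const_mul _ (hFx x)]
    refine lintegral_congr_ae ?_
    filter_upwards [hNfin] with t ht
    rw [hw]
    simp only
    rw [ENNReal.div_eq_inv_mul, mul_assoc, ENNReal.mul_div_cancel (hN0 t) ht]
  have hmeas2 : Measurable (Function.uncurry fun x t => w t * (F t x / N t) ^ q x) := by
    refine (hwm.comp measurable_snd).mul (Measurable.pow ?_ (hqm.comp measurable_fst))
    exact (hF.comp measurable_swap).div (hNmeas.comp measurable_snd)
  calc emodular ν q (fun x => (∫⁻ t, F t x ∂μ) / ENNReal.ofReal η)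
      = ∫⁻ x, (∫⁻ t, w t * (F t x / N t) ∂μ) ^ q x ∂ν := by simp only [emodular, hsplit]
    _ ≤ ∫⁻ x, ∫⁻ t, w t * (F t x / N t) ^ q x ∂μ ∂ν := by
        refine lintegral_mono fun x => ?_
        exact rpow_lintegral_mul_le hwm ((hFx x).div hNmeas) hw1 (hq x)
    _ = ∫⁻ t, ∫⁻ x, w t * (F t x / N t) ^ q x ∂ν ∂μ :=
        lintegral_lintegral_swap hmeas2.aemeasurable
    _ ≤ ∫⁻ t, w t ∂μ := by
        refine lintegral_mono_ae ?_
        filter_upwards [hNfin] with t ht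
        have hwt : w t ≠ ⊤ := ENNReal.div_ne_top ht hE0
        rw [lintegral_const_mul' _ _ hwt]
        refine mul_le_of_le_one_right' (emodular_div_le_one_of_luxNorm_lt hq0 ht ?_)
        have hfin : luxNorm ν q (F t) ≠ ⊤ := ne_top_of_le_ne_top ht le_self_add
        exact ENNReal.lt_add_right hfin (by simpa using (hδ0 t).ne')
    _ ≤ 1 := hw1

/-- Minkowski's integral inequality for almost everywhere measurable data. -/
lemma luxNorm_lintegral_le [SFinite ν] {μ : Measure T} [SigmaFinite μ]
    (hq : ∀ x, 1 < q x) (hqm : AEMeasurable q ν) {F : T → X → ℝ≥0∞}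
    (hF : AEMeasurable (Function.uncurry F) (μ.prod ν)) :
    luxNorm ν q (fun x => ∫⁻ t, F t x ∂μ) ≤ ∫⁻ t, luxNorm ν q (F t) ∂μ := by
  -- The measurable representative of the exponent is modified on a null set to stay above one.
  set q' : X → ℝ := fun x => if 1 < hqm.mk q x then hqm.mk q x else 2 with hq'
  have hq'm : Measurable q' :=
    Measurable.ite (measurableSet_lt measurable_const hqm.measurable_mk) hqm.measurable_mk
      measurable_const
  have hq'1 : ∀ x, 1 < q' x := by
    intro x
    simp only [hq']
    split_ifs with h
    · exact h
    · norm_num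
  have hqq' : q =ᵐ[ν] q' := by
    filter_upwards [hqm.ae_eq_mk] with x hx
    simp only [hq', ← hx, hq x, if_true]
  set F' : T → X → ℝ≥0∞ := fun t x => hF.mk _ (t, x) with hF'
  have hFF' : ∀ᵐ z ∂(μ.prod ν), F z.1 z.2 = F' z.1 z.2 := hF.ae_eq_mk
  have h1 : ∀ᵐ t ∂μ, luxNorm ν q (F t) = luxNorm ν q' (F' t) := by
    filter_upwards [Measure.ae_ae_of_ae_prod hFF'] with t ht
    rw [luxNorm_congr_exponent hqq', luxNorm_congr_ae ht]
  have hswap : ∀ᵐ z ∂(ν.prod μ), F z.2 z.1 = F' z.2 z.1 :=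
    Measure.measurePreserving_swap.quasiMeasurePreserving.ae hFF'
  have h2 : (fun x => ∫⁻ t, F t x ∂μ) =ᵐ[ν] fun x => ∫⁻ t, F' t x ∂μ := by
    filter_upwards [Measure.ae_ae_of_ae_prod hswap] with x hx
    exact lintegral_congr_ae hx
  rw [lintegral_congr_ae h1, luxNorm_congr_ae h2, luxNorm_congr_exponent hqq']
  exact luxNorm_lintegral_le_of_measurable hq'1 hq'm hF.measurable_mk

/-- The triangle inequality is Minkowski's inequality for the counting measure. -/
lemma luxNorm_sum_le [SFinite ν] {ι : Type*} (s : Finset ι) (hq : ∀ x, 1 < q x)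
    (hqm : AEMeasurable q ν) {F : ι → X → ℝ≥0∞} (hF : ∀ i, AEMeasurable (F i) ν) :
    luxNorm ν q (fun x => ∑ i ∈ s, F i x) ≤ ∑ i ∈ s, luxNorm ν q (F i) := by
  classical
  induction s using Finset.induction_on with
  | empty => simpa using (luxNorm_zero (ν := ν) fun x => by linarith [hq x]).le
  | insert a s ha ih =>
    simp_rw [Finset.sum_insert ha]
    refine le_trans ?_ (add_le_add_right ih _)
    set G : X → ℝ≥0∞ := fun x => ∑ i ∈ s, F i x with hG
    have hGm : AEMeasurable G ν := Finset.aemeasurable_fun_sum _ fun i _ => hF i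
    have := luxNorm_lintegral_le (T := Bool) (μ := Measure.count) hq hqm
      (F := fun b x => if b then F a x else G x) ?_
    · simpa [lintegral_count] using this
    · have hsnd := Measure.quasiMeasurePreserving_snd
        (μ := (Measure.count : Measure Bool)) (ν := ν)
      refine ⟨fun z => if z.1 = true then (hF a).mk _ z.2 else hGm.mk _ z.2,
        Measurable.ite (measurable_fst (measurableSet_singleton true))
          ((hF a).measurable_mk.comp measurable_snd) (hGm.measurable_mk.comp measurable_snd), ?_⟩
      filter_upwards [hsnd.ae (hF a).ae_eq_mk, hsnd.ae hGm.ae_eq_mk] with z h1 h2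
      simp only [Function.uncurry, ← h1, ← h2]

end Luxemburg

/-- An upper bound that is multilinear in strict upper bounds of finite numbers passes to the
numbers themselves. -/
lemma le_const_mul_prod_of_forall_lt {ι : Type*} [Fintype ι] {y C : ℝ≥0∞} {x : ι → ℝ≥0∞}
    (hx : ∀ i, x i ≠ ⊤) (hC : C ≠ ⊤)
    (h : ∀ η : ι → ℝ, (∀ i, 0 < η i ∧ x i < ENNReal.ofReal (η i)) →
      y ≤ C * ∏ i, ENNReal.ofReal (η i)) :
    y ≤ C * ∏ i, x i := by
  lift x to ι → ℝ≥0 using hx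
  lift C to ℝ≥0 using hC
  have hlim : Tendsto (fun ε : ℝ≥0 => ((C * ∏ i, (x i + ε) : ℝ≥0) : ℝ≥0∞)) (𝓝[>] 0)
      (𝓝 ((C * ∏ i, x i : ℝ≥0) : ℝ≥0∞)) := by
    refine ENNReal.tendsto_coe.2 (Tendsto.mono_left ?_ nhdsWithin_le_nhds)
    have : Continuous fun ε : ℝ≥0 => C * ∏ i, (x i + ε) := by fun_prop
    simpa using this.tendsto 0
  have key : y ≤ ((C * ∏ i, x i : ℝ≥0) : ℝ≥0∞) := by
    refine ge_of_tendsto hlim ?_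
    filter_upwards [self_mem_nhdsWithin] with ε hε
    have hε' : (0 : ℝ≥0) < ε := hε
    have := h (fun i => ((x i + ε : ℝ≥0) : ℝ)) fun i => ⟨by positivity, by
      rw [ENNReal.ofReal_coe_nnreal, ENNReal.coe_lt_coe]
      exact lt_add_of_pos_right _ hε'⟩
    simp only [ENNReal.ofReal_coe_nnreal] at this
    exact_mod_cast this
  simpa using key

/-! ### Linear changes of variables -/

section Act

variable {n : ℕ}

lemma act_mul (M N : Matrix (Fin n) (Fin n) ℝ) (x : Rn n) : act (M * N) x = act M (act N x) := by
  simp [act, Matrix.mulVec_mulVec]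

lemma act_one (x : Rn n) : act 1 x = x := by
  simp [act]

lemma act_inv_act {M : Matrix (Fin n) (Fin n) ℝ} (hM : IsUnit M) (x : Rn n) :
    act M⁻¹ (act M x) = x := by
  rw [← act_mul, Matrix.nonsing_inv_mul _ ((Matrix.isUnit_iff_isUnit_det M).1 hM), act_one]

lemma act_act_inv {M : Matrix (Fin n) (Fin n) ℝ} (hM : IsUnit M) (x : Rn n) :
    act M (act M⁻¹ x) = x := by
  rw [← act_mul, Matrix.mul_nonsing_inv _ ((Matrix.isUnit_iff_isUnit_det M).1 hM), act_one]

lemma isUnit_inv {M : Matrix (Fin n) (Fin n) ℝ} (hM : IsUnit M) : IsUnit M⁻¹ :=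
  Matrix.isUnit_nonsing_inv_iff.2 hM

lemma continuous_act (M : Matrix (Fin n) (Fin n) ℝ) : Continuous (act M) :=
  (Matrix.toLpLin 2 2 M).continuous_of_finiteDimensional

lemma matNorm_nonneg (M : Matrix (Fin n) (Fin n) ℝ) : 0 ≤ matNorm M := Real.sqrt_nonneg _

lemma norm_act_le (M : Matrix (Fin n) (Fin n) ℝ) (x : Rn n) : ‖act M x‖ ≤ matNorm M * ‖x‖ := by
  rw [matNorm, EuclideanSpace.norm_eq, EuclideanSpace.norm_eq, ← Real.sqrt_mul (by positivity)]
  refine Real.sqrt_le_sqrt ?_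
  rw [Finset.sum_mul]
  refine Finset.sum_le_sum fun j _ => ?_
  simpa [act, Matrix.mulVec, dotProduct] using
    Finset.sum_mul_sq_le_sq_mul_sq Finset.univ (fun k => M j k) (fun k => x k)

lemma addHaar_preimage_act {M : Matrix (Fin n) (Fin n) ℝ} (hM : IsUnit M) (s : Set (Rn n)) :
    volume (act M ⁻¹' s) = ENNReal.ofReal |M⁻¹.det| * volume s := by
  have hdet : LinearMap.det (Matrix.toLpLin 2 2 M : Rn n →ₗ[ℝ] Rn n) = M.det := by
    rw [LinearMap.det_toLpLin]
  have h0 : M.det ≠ 0 := ((Matrix.isUnit_iff_isUnit_det M).1 hM).ne_zero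
  have := Measure.addHaar_preimage_linearMap (volume : Measure (Rn n))
    (f := Matrix.toLpLin 2 2 M) (by rw [hdet]; exact h0) s
  rw [hdet] at this
  rwa [Matrix.det_nonsing_inv, Ring.inverse_eq_inv']

lemma quasiMeasurePreserving_act {M : Matrix (Fin n) (Fin n) ℝ} (hM : IsUnit M) :
    Measure.QuasiMeasurePreserving (act M) (volume : Measure (Rn n)) volume := by
  refine ⟨(continuous_act M).measurable, Measure.AbsolutelyContinuous.mk fun s hs h0 => ?_⟩
  rw [Measure.map_apply (continuous_act M).measurable hs, addHaar_preimage_act hM, h0, mul_zero]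

lemma lintegral_comp_act {M : Matrix (Fin n) (Fin n) ℝ} (hM : IsUnit M) (f : Rn n → ℝ≥0∞) :
    ∫⁻ x, f (act M x) = ENNReal.ofReal |M⁻¹.det| * ∫⁻ y, f y := by
  let e : Rn n ≃ᵐ Rn n :=
    { toFun := act M
      invFun := act M⁻¹
      left_inv := act_inv_act hM
      right_inv := act_act_inv hM
      measurable_toFun := (continuous_act M).measurable
      measurable_invFun := (continuous_act M⁻¹).measurable }
  have hmap : Measure.map e (volume : Measure (Rn n)) =
      ENNReal.ofReal |M⁻¹.det| • (volume : Measure (Rn n)) := by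
    refine Measure.ext fun s hs => ?_
    rw [e.map_apply]
    exact addHaar_preimage_act hM s
  have := lintegral_map_equiv (μ := volume) f e
  rw [hmap, lintegral_smul_measure] at this
  exact this.symm

end Act

/-! ### Variable exponents and linear changes of variables -/

section Exponents

variable {n : ℕ} {q : Rn n → ℝ}

lemma ClassPb.one_lt (hq : ClassPb q) (x : Rn n) : 1 < q x := hq.2.1.trans_le (hq.2.2 x).1

lemma ClassPb.expSup_pos (hq : ClassPb q) : 0 < expSup q := by
  linarith [hq.one_lt 0, (hq.2.2 0).2]

lemma lpVarNorm_eq_luxNorm (hq : ∀ x, 0 < q x) (f : Rn n → ℂ) :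
    lpVarNorm (fun x => ENNReal.ofReal (q x)) f = luxNorm volume q fun x => ‖f x‖ₑ := by
  have : ∀ η : ℝ, 0 < η → modular (fun x => ENNReal.ofReal (q x)) (fun x => f x / (η : ℂ)) =
      emodular volume q (fun x => ‖f x‖ₑ / ENNReal.ofReal η) := by
    intro η hη
    simp only [modular, emodular, ENNReal.ofReal_ne_top, ne_eq, not_false_eq_true,
      ENNReal.toReal_ofReal (hq _).le]
    have e1 : {x : Rn n | True} = Set.univ := rfl
    have e2 : {x : Rn n | False} = ∅ := rfl
    rw [e1, e2, Measure.restrict_univ, Measure.restrict_empty, eLpNorm_measure_zero, add_zero]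
    refine lintegral_congr fun x => ?_
    have hη' : ‖(η : ℂ)‖ₑ = ENNReal.ofReal η := by
      rw [← ofReal_norm, Complex.norm_real, Real.norm_of_nonneg hη.le]
    have hη0 : (η : ℂ) ≠ 0 := by exact_mod_cast hη.ne'
    rw [div_eq_mul_inv, enorm_mul, enorm_inv hη0, hη', div_eq_mul_inv]
  refine le_antisymm (le_iInf fun ⟨η, h0, h1⟩ => ?_) (le_iInf fun ⟨η, h0, h1⟩ => ?_)
  · exact iInf_le (fun η : {η : ℝ // 0 < η ∧
      modular (fun x => ENNReal.ofReal (q x)) (fun x => f x / (η : ℂ)) ≤ 1} =>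
        ENNReal.ofReal η.1) ⟨η, h0, (this η h0).trans_le h1⟩
  · exact luxNorm_le h0 ((this η h0).symm.trans_le h1)

/-- Composition with an invertible matrix moves its inverse into the exponent, at the cost of a
power of the Jacobian. -/
lemma luxNorm_comp_act_le (hq : ClassPb q) {M : Matrix (Fin n) (Fin n) ℝ} (hM : IsUnit M)
    (g : Rn n → ℝ≥0∞) :
    luxNorm volume q (fun x => g (act M x)) ≤
      ENNReal.ofReal (max (|M⁻¹.det| ^ (1 / expSup q)) (|M⁻¹.det| ^ (1 / expInf q))) *
        luxNorm volume (fun x => q (act M⁻¹ x)) g := by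
  set D : ℝ := |M⁻¹.det| with hD
  have hDpos : 0 < D := abs_pos.2 ((Matrix.isUnit_iff_isUnit_det _).1 (isUnit_inv hM)).ne_zero
  set c : ℝ := max (D ^ (1 / expSup q)) (D ^ (1 / expInf q)) with hc
  have hcpos : 0 < c := lt_max_of_lt_left (Real.rpow_pos_of_pos hDpos _)
  have hinf : 0 < expInf q := by linarith [hq.2.1]
  -- `D ≤ c ^ Q` for every exponent `Q` between `q₋` and `q₊`.
  have hDc : ∀ y, D ≤ c ^ q y := by
    intro y
    have hy : 0 < q y := by linarith [hq.one_lt y]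
    have h1 : D ^ (1 / q y) ≤ c := by
      rcases le_total 1 D with h | h
      · refine le_max_of_le_right (Real.rpow_le_rpow_of_exponent_le h ?_)
        exact one_div_le_one_div_of_le hinf (hq.2.2 y).1
      · refine le_max_of_le_left (Real.rpow_le_rpow_of_exponent_ge hDpos h ?_)
        exact one_div_le_one_div_of_le hy (hq.2.2 y).2
    calc D = (D ^ (1 / q y)) ^ q y := by
          rw [← Real.rpow_mul hDpos.le, one_div_mul_cancel hy.ne', Real.rpow_one]
      _ ≤ c ^ q y := Real.rpow_le_rpow (by positivity) h1 hy.le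
  have hC0 : ENNReal.ofReal c ≠ 0 := by simpa using hcpos
  rw [luxNorm.eq_def volume (fun x => q (act M⁻¹ x)) g,
    ENNReal.mul_iInf_of_ne hC0 ENNReal.ofReal_ne_top]
  refine le_iInf fun ⟨η, hη, h⟩ => ?_
  rw [← ENNReal.ofReal_mul hcpos.le]
  refine luxNorm_le (by positivity) (le_trans ?_ h)
  have hcov := lintegral_comp_act hM
    (fun y => (g y / ENNReal.ofReal (c * η)) ^ q (act M⁻¹ y))
  simp only [act_inv_act hM] at hcov
  rw [emodular, hcov, ← lintegral_const_mul' _ _ ENNReal.ofReal_ne_top]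
  refine lintegral_mono fun y => ?_
  change _ ≤ (g y / ENNReal.ofReal η) ^ q (act M⁻¹ y)
  set Q := q (act M⁻¹ y) with hQ
  have hQ0 : 0 ≤ Q := by linarith [hq.one_lt (act M⁻¹ y)]
  have e : g y / ENNReal.ofReal η = ENNReal.ofReal c * (g y / ENNReal.ofReal (c * η)) := by
    rw [ENNReal.ofReal_mul hcpos.le, ← mul_div_assoc,
      ENNReal.mul_div_mul_left _ _ hC0 ENNReal.ofReal_ne_top]
  rw [e, ENNReal.mul_rpow_of_nonneg _ _ hQ0, ENNReal.ofReal_rpow_of_pos hcpos]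
  gcongr
  exact hDc _

/-- A weighted geometric mean in `[0, ∞]` is at most the sum. -/
lemma prod_rpow_le_sum {ι : Type*} (s : Finset ι) (z : ι → ℝ≥0∞) (w : ι → ℝ)
    (hw : ∀ i ∈ s, 0 ≤ w i) (hsum : ∑ i ∈ s, w i = 1) : ∏ i ∈ s, z i ^ w i ≤ ∑ i ∈ s, z i := by
  have key : ∀ (Z : ℝ≥0∞) (t : Finset ι), (∀ i ∈ t, 0 ≤ w i) →
      ∏ i ∈ t, Z ^ w i = Z ^ ∑ i ∈ t, w i := by
    classical
    intro Z t
    induction t using Finset.induction_on with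
    | empty => simp
    | insert a t ha ih =>
      intro ht
      rw [Finset.prod_insert ha, Finset.sum_insert ha, ENNReal.rpow_add_of_nonneg _ _
        (ht a (by simp)) (Finset.sum_nonneg fun i hi => ht i (by simp [hi])),
        ih fun i hi => ht i (by simp [hi])]
  calc ∏ i ∈ s, z i ^ w i ≤ ∏ i ∈ s, (∑ j ∈ s, z j) ^ w i :=
        Finset.prod_le_prod' fun i hi =>
          ENNReal.rpow_le_rpow (Finset.single_le_sum (fun _ _ => zero_le) hi) (hw i hi)
    _ = ∑ i ∈ s, z i := by rw [key _ s hw, hsum, ENNReal.rpow_one]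

lemma mul_rpow_le_add {a b : ℝ≥0∞} {v w : ℝ} (hv : 0 ≤ v) (hw : 0 ≤ w) (h : v + w = 1) :
    a ^ v * b ^ w ≤ a + b := by
  have := prod_rpow_le_sum Finset.univ ![a, b] ![v, w] (by simp [hv, hw]) (by simpa using h)
  simpa using this

lemma aemeasurable_comp_act (hq : AEMeasurable q volume) {M : Matrix (Fin n) (Fin n) ℝ}
    (hM : IsUnit M) : AEMeasurable (fun x => q (act M x)) volume :=
  hq.comp_quasiMeasurePreserving (quasiMeasurePreserving_act hM)

lemma thetaExp_ne_top_iff {ζ : ℝ} {M : Matrix (Fin n) (Fin n) ℝ} {x : Rn n} :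
    thetaExp ζ q M x ≠ ⊤ ↔ 0 < 1 / q (act M⁻¹ x) - 1 / (ζ * q x) := by
  simp [thetaExp]

lemma toReal_thetaExp {ζ : ℝ} {M : Matrix (Fin n) (Fin n) ℝ} {x : Rn n}
    (h : 0 < 1 / q (act M⁻¹ x) - 1 / (ζ * q x)) :
    (thetaExp ζ q M x).toReal = (1 / q (act M⁻¹ x) - 1 / (ζ * q x))⁻¹ := by
  rw [thetaExp, ENNReal.toReal_inv, ENNReal.toReal_ofReal h.le]

/-- Replacing the exponent `q` by the smaller exponent `q ∘ M⁻¹` costs the norm `‖1‖_{L^ϑ}`: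
Hölder's inequality for `1 / q(M⁻¹ x) = 1 / q(x) + 1 / ϑ(x)`. -/
lemma luxNorm_act_inv_exponent_le (hq : ClassPb q) {M : Matrix (Fin n) (Fin n) ℝ}
    (hle : ∀ᵐ x ∂(volume : Measure (Rn n)), q (act M⁻¹ x) ≤ q x) {g : Rn n → ℝ≥0∞}
    (hg : AEMeasurable g volume) (hgfin : luxNorm volume q g ≠ ⊤) (hθ : thetaNorm 1 q M ≠ ⊤) :
    luxNorm volume (fun x => q (act M⁻¹ x)) g ≤ 2 * (thetaNorm 1 q M * luxNorm volume q g) := by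
  have h := le_const_mul_prod_of_forall_lt (y := luxNorm volume (fun x => q (act M⁻¹ x)) g)
    (C := 2) (x := ![thetaNorm 1 q M, luxNorm volume q g])
    (by simp [Fin.forall_fin_two, hgfin, hθ]) (by simp) ?_
  · simpa using h
  intro η hη
  obtain ⟨⟨hη0, hη0'⟩, ⟨hη1, hη1'⟩⟩ := Fin.forall_fin_two.1 hη
  simp only [Matrix.cons_val_zero, Matrix.cons_val_one] at hη0' hη1'
  obtain ⟨⟨ε, hε, hmod⟩, hεη⟩ := iInf_lt_iff.1 hη0'
  simp only at hεη
  have hg1 := emodular_le_one_of_luxNorm_lt (fun x => by linarith [hq.one_lt x]) hη1'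
  set b : ℝ≥0∞ := ‖(1 : ℂ) / (ε : ℂ)‖ₑ with hb
  have hbε : b = (ENNReal.ofReal ε)⁻¹ := by
    rw [hb, one_div, enorm_inv (by exact_mod_cast hε.ne'), ← ofReal_norm,
      Complex.norm_real, Real.norm_of_nonneg hε.le]
  set S : Set (Rn n) := {x | thetaExp 1 q M x ≠ ⊤} with hS
  have hmod1 : ∫⁻ x in S, b ^ (thetaExp 1 q M x).toReal ≤ 1 := le_self_add.trans hmod
  have hmod2 : eLpNorm (fun _ : Rn n => (1 : ℂ) / (ε : ℂ)) ⊤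
      (volume.restrict {x | thetaExp 1 q M x = ⊤}) ≤ 1 := le_add_self.trans hmod
  -- Either the set where `ϑ = ∞` is null, or the constant is at most one.
  have hb1 : ∀ᵐ x ∂(volume : Measure (Rn n)), thetaExp 1 q M x = ⊤ → b ≤ 1 := by
    by_cases h0 : volume {x | thetaExp 1 q M x = ⊤} = 0
    · filter_upwards [measure_eq_zero_iff_ae_notMem.1 h0] with x hx hx'
      exact absurd hx' hx
    · rw [eLpNorm_const _ (by simp) (by simpa using h0)] at hmod2
      exact ae_of_all _ fun x _ => by simpa [hb] using hmod2
  have hpt : ∀ᵐ x ∂(volume : Measure (Rn n)),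
      (g x / ENNReal.ofReal (ε * η 1)) ^ q (act M⁻¹ x) ≤
        (g x / ENNReal.ofReal (η 1)) ^ q x +
          S.indicator (fun x => b ^ (thetaExp 1 q M x).toReal) x := by
    filter_upwards [hle, hb1] with x hx hx1
    have hQ := hq.one_lt (act M⁻¹ x)
    have hqx := hq.one_lt x
    set Q := q (act M⁻¹ x) with hQdef
    have e : g x / ENNReal.ofReal (ε * η 1) = g x / ENNReal.ofReal (η 1) * b := by
      rw [ENNReal.ofReal_mul hε.le, hbε, div_eq_mul_inv, div_eq_mul_inv,
        ENNReal.mul_inv (by simp [hε]) (by simp), mul_comm _ (ENNReal.ofReal (η 1))⁻¹, mul_assoc]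
    rw [e, ENNReal.mul_rpow_of_nonneg _ _ (by linarith)]
    by_cases hxS : x ∈ S
    · have hpos := thetaExp_ne_top_iff.1 hxS
      rw [Set.indicator_of_mem hxS, toReal_thetaExp hpos]
      rw [one_mul] at hpos ⊢
      have e1 : (g x / ENNReal.ofReal (η 1)) ^ Q =
          ((g x / ENNReal.ofReal (η 1)) ^ q x) ^ (Q / q x) := by
        rw [← ENNReal.rpow_mul, mul_div_cancel₀ _ (by linarith)]
      have e2 : b ^ Q = (b ^ (1 / Q - 1 / q x)⁻¹) ^ (1 - Q / q x) := by
        rw [← ENNReal.rpow_mul]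
        congr 1
        have : 1 - Q / q x = (1 / Q - 1 / q x) * Q := by field_simp
        rw [this, inv_mul_cancel_left₀ hpos.ne']
      rw [e1, e2]
      refine mul_rpow_le_add (by positivity) ?_ (by ring)
      rw [sub_nonneg, div_le_one (by linarith)]
      exact hx
    · have htop : thetaExp 1 q M x = ⊤ := by simpa [hS] using hxS
      have hnpos : ¬ 0 < 1 / Q - 1 / (1 * q x) := fun h => thetaExp_ne_top_iff.2 h htop
      have hqQ : q x ≤ Q := by
        rw [one_mul, sub_pos, not_lt] at hnpos
        exact (one_div_le_one_div (by linarith) (by linarith)).1 hnpos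
      rw [le_antisymm hx hqQ]
      exact (mul_le_of_le_one_right' (ENNReal.rpow_le_one (hx1 htop) (by linarith))).trans
        le_self_add
  have htotal : emodular volume (fun x => q (act M⁻¹ x))
      (fun x => g x / ENNReal.ofReal (ε * η 1)) ≤ ENNReal.ofReal 2 := by
    calc _ ≤ ∫⁻ x, (g x / ENNReal.ofReal (η 1)) ^ q x +
          S.indicator (fun x => b ^ (thetaExp 1 q M x).toReal) x := lintegral_mono_ae hpt
      _ = emodular volume q (fun x => g x / ENNReal.ofReal (η 1)) +
          ∫⁻ x, S.indicator (fun x => b ^ (thetaExp 1 q M x).toReal) x :=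
          lintegral_add_left' ((hg.div_const _).pow hq.1) _
      _ ≤ 1 + 1 := add_le_add hg1 ((lintegral_indicator_le _ _).trans hmod1)
      _ = ENNReal.ofReal 2 := by norm_num
  have hfin := luxNorm_le_mul_of_emodular_le (fun x => (hq.one_lt (act M⁻¹ x)).le)
    (mul_pos hε hη1) one_le_two htotal
  refine hfin.trans ?_
  rw [Fin.prod_univ_two, ENNReal.ofReal_mul zero_le_two, ENNReal.ofReal_mul hε.le,
    ENNReal.ofReal_ofNat]
  gcongr

/-- Finiteness of `‖1‖_{L^ϑ}` makes the superlevel sets of `1 / ϑ` finite in measure. -/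
lemma volume_lt_one_div_thetaExp_lt_top {ζ : ℝ} (hq : AEMeasurable q volume)
    {M : Matrix (Fin n) (Fin n) ℝ} (hM : IsUnit M) (hθ : thetaNorm ζ q M < ⊤) {ε : ℝ}
    (hε : 0 < ε) : volume {x | ε < 1 / q (act M⁻¹ x) - 1 / (ζ * q x)} < ⊤ := by
  obtain ⟨⟨η, hη, hmod⟩, -⟩ := iInf_lt_iff.1 hθ
  set b : ℝ≥0∞ := ‖(1 : ℂ) / (η : ℂ)‖ₑ with hb
  have hb0 : b ≠ 0 := by simp [hb, hη.ne']
  set S : Set (Rn n) := {x | thetaExp ζ q M x ≠ ⊤} with hS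
  have hmod1 : ∫⁻ x in S, b ^ (thetaExp ζ q M x).toReal ≤ 1 := le_self_add.trans hmod
  set κ : ℝ≥0∞ := (min b 1) ^ (1 / ε) with hκ
  have hκ0 : κ ≠ 0 := by
    have h1 : min b 1 ≠ 0 := by simp [hb0]
    have h2 : min b 1 ≠ ⊤ := ne_top_of_le_ne_top ENNReal.one_ne_top (min_le_right _ _)
    exact (ENNReal.rpow_pos (pos_iff_ne_zero.2 h1) h2).ne'
  have hmeas : AEMeasurable (fun x => b ^ (thetaExp ζ q M x).toReal) (volume.restrict S) := by
    have h1 := aemeasurable_comp_act hq (isUnit_inv hM)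
    refine (aemeasurable_const.pow ?_).restrict
    unfold thetaExp
    exact (((h1.const_div _).sub ((hq.const_mul _).const_div _)).ennreal_ofReal.inv).ennreal_toReal
  have hch := (mul_meas_ge_le_lintegral₀ hmeas κ).trans hmod1
  have hsub : {x | ε < 1 / q (act M⁻¹ x) - 1 / (ζ * q x)} ⊆ S := fun x hx =>
    thetaExp_ne_top_iff.2 (hε.trans hx)
  rw [← Measure.restrict_eq_self volume hsub]
  refine (measure_mono (t := {x | κ ≤ b ^ (thetaExp ζ q M x).toReal}) fun x hx => ?_).trans_lt
    (?_ : _ < ⊤)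
  · have hx' : ε < 1 / q (act M⁻¹ x) - 1 / (ζ * q x) := hx
    change κ ≤ b ^ (thetaExp ζ q M x).toReal
    rw [toReal_thetaExp (hε.trans hx')]
    refine le_trans ?_ (ENNReal.rpow_le_rpow (min_le_left b 1) (by
      rw [inv_nonneg]; exact (hε.trans hx').le))
    refine ENNReal.rpow_le_rpow_of_exponent_ge (min_le_right _ _) ?_
    exact (inv_anti₀ hε hx'.le).trans (one_div ε).ge
  · by_contra hcon
    rw [not_lt, top_le_iff] at hcon
    rw [hcon, ENNReal.mul_top hκ0] at hch
    simp at hch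

/-- The hypotheses `q(M⁻¹ x) ≤ ζ q(x)` and `‖1‖_{L^ϑ} < ∞` can hold for a single invertible matrix
only if `ζ = 1`. If `ζ < 1`, iterating the inequality drives `q` below one. If `ζ > 1`, then
`1 / q ∘ M⁻¹` is at most `ζ⁻¹ / q` up to a small error off a set of finite measure, and iterating
bounds `1 / q` by an arbitrarily small constant off a set of finite measure. -/
lemma eq_one_of_thetaNorm_lt_top (hn : 1 ≤ n) (hq : ClassPb q) {ζ : ℝ} (hζ : 0 < ζ)
    {M : Matrix (Fin n) (Fin n) ℝ} (hM : IsUnit M)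
    (hle : ∀ᵐ x ∂(volume : Measure (Rn n)), q (act M⁻¹ x) ≤ ζ * q x)
    (hθ : thetaNorm ζ q M < ⊤) : ζ = 1 := by
  have hsup := hq.expSup_pos
  rcases lt_trichotomy ζ 1 with h | h | h
  · exfalso
    have hiter : ∀ k : ℕ, ∀ᵐ x ∂(volume : Measure (Rn n)),
        q (act (M⁻¹ ^ k) x) ≤ ζ ^ k * q x := by
      intro k
      induction k with
      | zero => simp [act_one]
      | succ k ih =>
        filter_upwards [hle, (quasiMeasurePreserving_act (isUnit_inv hM)).ae ih] with x h1 h2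
        rw [pow_succ, act_mul, pow_succ, mul_assoc]
        exact h2.trans (mul_le_mul_of_nonneg_left h1 (by positivity))
    obtain ⟨k, hk⟩ := exists_pow_lt_of_lt_one (one_div_pos.2 hsup) h
    obtain ⟨x, hx⟩ := (hiter k).exists
    have h1 := hq.one_lt (act (M⁻¹ ^ k) x)
    have h2 : ζ ^ k * q x ≤ ζ ^ k * expSup q :=
      mul_le_mul_of_nonneg_left (hq.2.2 x).2 (by positivity)
    have h3 : ζ ^ k * expSup q < 1 := by rwa [lt_div_iff₀ hsup] at hk
    linarith
  · exact h
  · exfalso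
    have hζ1 : ζ⁻¹ < 1 := inv_lt_one_of_one_lt₀ h
    set δ : ℝ := 1 / (2 * expSup q) with hδ
    have hδpos : 0 < δ := by positivity
    have hεpos : 0 < δ * (1 - ζ⁻¹) := mul_pos hδpos (by linarith)
    have hfin := volume_lt_one_div_thetaExp_lt_top hq.1 hM hθ hεpos
    have hiter : ∀ k : ℕ, volume {x : Rn n | ζ⁻¹ ^ k + δ < 1 / q x} < ⊤ := by
      intro k
      induction k with
      | zero =>
        have : {x : Rn n | ζ⁻¹ ^ 0 + δ < 1 / q x} = ∅ := by
          refine Set.eq_empty_of_forall_notMem fun x hx => ?_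
          have hx' : ζ⁻¹ ^ 0 + δ < 1 / q x := hx
          have : 1 / q x < 1 := by
            rw [div_lt_one (by linarith [hq.one_lt x])]
            exact hq.one_lt x
          rw [pow_zero] at hx'
          linarith
        rw [this, measure_empty]
        exact ENNReal.zero_lt_top
      | succ k ih =>
        set E : Set (Rn n) := {x | ζ⁻¹ ^ (k + 1) + δ < 1 / q x} with hE
        have hEM : E = act M ⁻¹' (act M⁻¹ ⁻¹' E) := by
          ext x
          simp [act_inv_act hM]
        rw [hEM, addHaar_preimage_act hM]
        refine ENNReal.mul_lt_top ENNReal.ofReal_lt_top ?_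
        refine (measure_mono (t := {x : Rn n | ζ⁻¹ ^ k + δ < 1 / q x} ∪
          {x | δ * (1 - ζ⁻¹) < 1 / q (act M⁻¹ x) - 1 / (ζ * q x)}) ?_).trans_lt
          ((measure_union_le _ _).trans_lt (ENNReal.add_lt_top.2 ⟨ih, hfin⟩))
        intro x hx
        have hx' : ζ⁻¹ ^ (k + 1) + δ < 1 / q (act M⁻¹ x) := hx
        by_contra hcon
        rw [Set.mem_union, not_or] at hcon
        have h1 : 1 / q x ≤ ζ⁻¹ ^ k + δ := not_lt.1 hcon.1
        have h2 : 1 / q (act M⁻¹ x) - 1 / (ζ * q x) ≤ δ * (1 - ζ⁻¹) := not_lt.1 hcon.2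
        have h3 : 1 / (ζ * q x) = ζ⁻¹ * (1 / q x) := by
          rw [one_div, mul_inv, one_div]
        have h4 : ζ⁻¹ * (1 / q x) ≤ ζ⁻¹ * (ζ⁻¹ ^ k + δ) :=
          mul_le_mul_of_nonneg_left h1 (by positivity)
        have h5 : ζ⁻¹ * (ζ⁻¹ ^ k + δ) = ζ⁻¹ ^ (k + 1) + ζ⁻¹ * δ := by ring
        nlinarith
    obtain ⟨k, hk⟩ := exists_pow_lt_of_lt_one hδpos hζ1
    have huniv : {x : Rn n | ζ⁻¹ ^ k + δ < 1 / q x} = Set.univ := by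
      refine Set.eq_univ_of_forall fun x => ?_
      change ζ⁻¹ ^ k + δ < 1 / q x
      have h1 : 1 / expSup q ≤ 1 / q x :=
        one_div_le_one_div_of_le (by linarith [hq.one_lt x]) (hq.2.2 x).2
      have h2 : δ + δ = 1 / expSup q := by rw [hδ]; field_simp; norm_num
      linarith
    have hlt := hiter k
    have : Nonempty (Fin n) := ⟨⟨0, hn⟩⟩
    have : NoncompactSpace (Rn n) := NormedSpace.noncompactSpace ℝ (Rn n)
    rw [huniv, measure_univ_of_isAddLeftInvariant] at hlt
    exact lt_irrefl _ hlt

end Exponents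

/-! ### Dyadic annuli -/

section Dyadic

variable {n : ℕ}

lemma mem_annulus_iff {k : ℤ} {x : Rn n} :
    x ∈ annulus n k ↔ (2 : ℝ) ^ ((k : ℝ) - 1) < ‖x‖ ∧ ‖x‖ ≤ (2 : ℝ) ^ (k : ℝ) := by
  have h : (2 : ℝ) ^ ((k : ℝ) - 1) = (2 : ℝ) ^ (k - 1) := by
    rw [← Real.rpow_intCast]
    push_cast
    rfl
  rw [h, Real.rpow_intCast]
  simp only [annulus, Set.mem_sdiff, Metric.mem_closedBall, dist_zero_right, not_le]
  exact and_comm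

lemma norm_pos_of_mem_annulus {k : ℤ} {x : Rn n} (hx : x ∈ annulus n k) : 0 < ‖x‖ :=
  (Real.rpow_pos_of_pos two_pos _).trans (mem_annulus_iff.1 hx).1

lemma measurableSet_annulus (k : ℤ) : MeasurableSet (annulus n k) :=
  Metric.isClosed_closedBall.measurableSet.diff Metric.isClosed_closedBall.measurableSet

lemma exists_rpow_two_bounds {c : ℝ} (hc : 0 < c) :
    ∃ k : ℤ, (2 : ℝ) ^ ((k : ℝ) - 1) < c ∧ c ≤ (2 : ℝ) ^ (k : ℝ) := by
  obtain ⟨k, h1, h2⟩ := exists_mem_Ioc_zpow hc one_lt_two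
  refine ⟨k + 1, ?_, ?_⟩
  · push_cast
    rw [add_sub_cancel_right, Real.rpow_intCast]
    exact h1
  · rw [Real.rpow_intCast]
    exact h2

lemma exists_mem_annulus {x : Rn n} (hx : x ≠ 0) : ∃ k : ℤ, x ∈ annulus n k := by
  obtain ⟨k, hk⟩ := exists_rpow_two_bounds (norm_pos_iff.2 hx)
  exact ⟨k, mem_annulus_iff.2 hk⟩

/-- Powers of numbers comparable to a power of two. -/
lemma rpow_two_mul_le {c κ : ℝ} (h1 : (2 : ℝ) ^ (κ - 1) ≤ c) (h2 : c ≤ (2 : ℝ) ^ κ) (a : ℝ) :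
    (2 : ℝ) ^ (κ * a) ≤ (2 : ℝ) ^ |a| * c ^ a ∧ c ^ a ≤ (2 : ℝ) ^ |a| * (2 : ℝ) ^ (κ * a) := by
  have hp : ∀ b : ℝ, (0 : ℝ) < 2 ^ b := fun b => Real.rpow_pos_of_pos two_pos b
  have hc : 0 < c := (hp _).trans_le h1
  have hup : ∀ b, 0 ≤ b → c ^ b ≤ (2 : ℝ) ^ (κ * b) := fun b hb => by
    rw [Real.rpow_mul two_pos.le]
    exact Real.rpow_le_rpow hc.le h2 hb
  have hlow : ∀ b, 0 ≤ b → (2 : ℝ) ^ (κ * b) ≤ (2 : ℝ) ^ b * c ^ b := fun b hb => by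
    have := Real.rpow_le_rpow (hp _).le h1 hb
    rw [← Real.rpow_mul two_pos.le] at this
    calc (2 : ℝ) ^ (κ * b) = (2 : ℝ) ^ b * (2 : ℝ) ^ ((κ - 1) * b) := by
          rw [← Real.rpow_add two_pos]; ring_nf
      _ ≤ _ := by gcongr
  have hone : ∀ b : ℝ, 0 ≤ b → (1 : ℝ) ≤ (2 : ℝ) ^ b := fun b hb => Real.one_le_rpow one_le_two hb
  rcases le_total 0 a with ha | ha
  · rw [abs_of_nonneg ha]
    exact ⟨hlow a ha, (hup a ha).trans (le_mul_of_one_le_left (hp _).le (hone a ha))⟩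
  · rw [abs_of_nonpos ha]
    have h3 := hup (-a) (by linarith)
    have h4 := hlow (-a) (by linarith)
    have hca : 0 < c ^ a := Real.rpow_pos_of_pos hc a
    rw [mul_neg, Real.rpow_neg hc.le, Real.rpow_neg two_pos.le] at h3 h4
    have h5 : (2 : ℝ) ^ (κ * a) ≤ c ^ a := (inv_le_inv₀ hca (hp _)).1 h3
    refine ⟨h5.trans (le_mul_of_one_le_left hca.le (hone _ (by linarith))), ?_⟩
    rw [← div_eq_mul_inv, le_div_iff₀ hca, ← div_eq_inv_mul, div_le_iff₀ (hp _)] at h4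
    exact h4

/-- The value near which `α` lives on the annulus `C_k`: its value at the origin for `k ≤ 0`, its
value at infinity for `k > 0`. -/
noncomputable def dyadicValue (a₀ ainf : ℝ) (k : ℤ) : ℝ := if k ≤ 0 then a₀ else ainf

/-- Log-Hölder continuity at the origin and at infinity makes `2^{kα(x)}` comparable to a constant
on `C_k`, uniformly in `k`. -/
lemma exists_abs_mul_sub_dyadicValue_le {α : Rn n → ℝ} {ainf : ℝ} (h0 : LogHolderAtZero α)
    (hinf : LogHolderAtInfty α ainf) :
    ∃ K : ℝ, 0 ≤ K ∧ ∀ (k : ℤ) (x : Rn n), x ∈ annulus n k →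
      |(k : ℝ) * (α x - dyadicValue (α 0) ainf k)| ≤ K := by
  obtain ⟨C, hC⟩ := h0
  obtain ⟨C', hC'⟩ := hinf
  have hlog2 : 0 < Real.log 2 := Real.log_pos one_lt_two
  have he : (2 : ℝ) ≤ Real.exp 1 := by linarith [Real.add_one_le_exp (1 : ℝ)]
  have aux : ∀ {c d L κ : ℝ}, 0 ≤ κ → κ * Real.log 2 ≤ L → 0 < L → |d| ≤ c / L →
      κ * |d| ≤ |c| / Real.log 2 := by
    intro c d L κ hκ hκL hL hd
    rw [le_div_iff₀ hlog2]
    calc κ * |d| * Real.log 2 = κ * Real.log 2 * |d| := by ring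
      _ ≤ L * (c / L) := mul_le_mul hκL hd (abs_nonneg _) hL.le
      _ = c := by field_simp
      _ ≤ |c| := le_abs_self c
  refine ⟨|C| / Real.log 2 + 2 * (|C'| / Real.log 2), by positivity, fun k x hx => ?_⟩
  have hxpos := norm_pos_of_mem_annulus hx
  obtain ⟨hx1, hx2⟩ := mem_annulus_iff.1 hx
  rw [abs_mul]
  by_cases hk : k ≤ 0
  · have hkR : (k : ℝ) ≤ 0 := by exact_mod_cast hk
    rw [dyadicValue, if_pos hk, abs_of_nonpos hkR]
    have h := aux (c := C) (d := α x - α 0)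
      (L := Real.log (Real.exp 1 + 1 / ‖x‖)) (κ := -(k : ℝ)) (by linarith) ?_ ?_ (hC x)
    · have : 0 ≤ |C'| / Real.log 2 := by positivity
      linarith
    · rw [← Real.log_rpow two_pos]
      refine Real.log_le_log (Real.rpow_pos_of_pos two_pos _) ?_
      have : (2 : ℝ) ^ (-(k : ℝ)) ≤ 1 / ‖x‖ := by
        rw [Real.rpow_neg two_pos.le, ← one_div]
        exact one_div_le_one_div_of_le hxpos hx2
      linarith
    · refine Real.log_pos ?_
      have : 0 < 1 / ‖x‖ := by positivity
      linarith
  · have hkR : (1 : ℝ) ≤ k := by exact_mod_cast (by lia : 1 ≤ k)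
    rw [dyadicValue, if_neg hk, abs_of_nonneg (by linarith)]
    have h := aux (c := C') (d := α x - ainf)
      (L := Real.log (Real.exp 1 + ‖x‖)) (κ := (k : ℝ) / 2) (by linarith) ?_ ?_ (hC' x)
    · have : 0 ≤ |C| / Real.log 2 := by positivity
      linarith
    · rw [← Real.log_rpow two_pos]
      refine Real.log_le_log (Real.rpow_pos_of_pos two_pos _) ?_
      rcases eq_or_lt_of_le hkR with h1 | h1
      · have : (2 : ℝ) ^ ((k : ℝ) / 2) ≤ 2 ^ (1 : ℝ) :=
          Real.rpow_le_rpow_of_exponent_le one_le_two (by linarith)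
        rw [Real.rpow_one] at this
        linarith
      · have h2 : (2 : ℝ) ≤ k := by
          exact_mod_cast (by have : (1 : ℤ) < k := by exact_mod_cast h1
                             lia : (2 : ℤ) ≤ k)
        have : (2 : ℝ) ^ ((k : ℝ) / 2) ≤ 2 ^ ((k : ℝ) - 1) :=
          Real.rpow_le_rpow_of_exponent_le one_le_two (by linarith)
        linarith
    · exact Real.log_pos (by linarith)

/-- The exponents on the source annulus `C_k` and on the image annulus `C_{k+j}` combine, up to the
choice of one of the two limiting values of `α`. When the annuli lie on different sides of the unit
sphere this uses `α(0) ≥ α_∞`. -/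
lemma exists_dyadicValue_exponent_le {a₀ ainf lam : ℝ} (h : ainf ≤ a₀) (k j : ℤ) :
    ∃ a, (a = a₀ ∨ a = ainf) ∧
      (k : ℝ) * dyadicValue a₀ ainf k + ((k + j : ℤ) : ℝ) * (lam - dyadicValue a₀ ainf (k + j)) ≤
        k * lam + j * (lam - a) := by
  unfold dyadicValue
  push_cast
  by_cases hk : k ≤ 0 <;> by_cases hl : k + j ≤ 0
  · exact ⟨a₀, Or.inl rfl, by simp only [hk, hl, if_true]; apply le_of_eq; ring⟩
  · refine ⟨ainf, Or.inr rfl, ?_⟩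
    simp only [hk, hl, if_true, if_false]
    have : (k : ℝ) ≤ 0 := by exact_mod_cast hk
    nlinarith
  · refine ⟨a₀, Or.inl rfl, ?_⟩
    simp only [hk, hl, if_true, if_false]
    have : (0 : ℝ) ≤ k := by exact_mod_cast (not_le.1 hk).le
    nlinarith
  · exact ⟨ainf, Or.inr rfl, by simp only [hk, hl, if_false]; apply le_of_eq; ring⟩

lemma matNorm_pos (hn : 1 ≤ n) {M : Matrix (Fin n) (Fin n) ℝ} (hM : IsUnit M) :
    0 < matNorm M := by
  have : Nonempty (Fin n) := ⟨⟨0, hn⟩⟩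
  obtain ⟨x, hx⟩ := exists_ne (0 : Rn n)
  refine lt_of_le_of_ne (matNorm_nonneg M) fun h => ?_
  have h1 := norm_act_le M x
  rw [← h, zero_mul] at h1
  have h2 := norm_act_le M⁻¹ (act M x)
  rw [act_inv_act hM, le_antisymm h1 (norm_nonneg _), mul_zero] at h2
  exact hx (norm_le_zero_iff.1 h2)

/-- A matrix with `‖M‖ ‖M⁻¹‖ < 2^{-θ}` maps an annulus into `2 - θ` consecutive annuli. -/
lemma exists_act_mem_annulus {M : Matrix (Fin n) (Fin n) ℝ} (hM : IsUnit M)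
    {ρ θ k : ℤ} (h1 : (2 : ℝ) ^ ((ρ : ℝ) - 1) < matNorm M) (h2 : matNorm M ≤ (2 : ℝ) ^ (ρ : ℝ))
    (hθ : matNorm M * matNorm M⁻¹ < (2 : ℝ) ^ (-θ)) {x : Rn n} (hx : x ∈ annulus n k) :
    ∃ s ∈ Finset.Icc (θ - 1) 0, act M x ∈ annulus n (k + (ρ + s)) := by
  have hp : ∀ b : ℝ, (0 : ℝ) < 2 ^ b := fun b => Real.rpow_pos_of_pos two_pos b
  have hxpos := norm_pos_of_mem_annulus hx
  obtain ⟨hx1, hx2⟩ := mem_annulus_iff.1 hx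
  have hxy := norm_act_le M⁻¹ (act M x)
  rw [act_inv_act hM] at hxy
  have hyx := norm_act_le M x
  have hy0 : act M x ≠ 0 := by
    intro h
    rw [h, norm_zero, mul_zero] at hxy
    linarith
  have hypos := norm_pos_iff.2 hy0
  obtain ⟨l, hl⟩ := exists_mem_annulus hy0
  obtain ⟨hl1, hl2⟩ := mem_annulus_iff.1 hl
  have hθ' : matNorm M * matNorm M⁻¹ < (2 : ℝ) ^ (-(θ : ℝ)) := by
    rw [← Int.cast_neg, Real.rpow_intCast]
    exact hθ
  have hup : l ≤ k + ρ := by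
    have : (2 : ℝ) ^ ((l : ℝ) - 1) < 2 ^ ((ρ : ℝ) + k) := by
      rw [Real.rpow_add two_pos]
      calc _ < _ := hl1
        _ ≤ _ := hyx
        _ ≤ _ := by gcongr
    rw [Real.rpow_lt_rpow_left_iff one_lt_two] at this
    have : l - 1 < ρ + k := by exact_mod_cast this
    lia
  have hlow : k + ρ + θ - 1 ≤ l := by
    have hinv : (2 : ℝ) ^ ((ρ : ℝ) - 1) * ‖x‖ ≤ 2 ^ (-(θ : ℝ)) * ‖act M x‖ := by
      calc (2 : ℝ) ^ ((ρ : ℝ) - 1) * ‖x‖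
          ≤ matNorm M * (matNorm M⁻¹ * ‖act M x‖) :=
            mul_le_mul h1.le hxy hxpos.le (matNorm_nonneg M)
        _ = matNorm M * matNorm M⁻¹ * ‖act M x‖ := by ring
        _ ≤ _ := by gcongr
    have : (2 : ℝ) ^ (((ρ : ℝ) - 1) + (k - 1)) < 2 ^ (-(θ : ℝ) + l) := by
      rw [Real.rpow_add two_pos, Real.rpow_add two_pos]
      calc _ < (2 : ℝ) ^ ((ρ : ℝ) - 1) * ‖x‖ := by gcongr
        _ ≤ _ := hinv
        _ ≤ _ := by gcongr
    rw [Real.rpow_lt_rpow_left_iff one_lt_two] at this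
    have : ρ - 1 + (k - 1) < -θ + l := by exact_mod_cast this
    lia
  refine ⟨l - k - ρ, Finset.mem_Icc.2 ⟨by lia, by lia⟩, ?_⟩
  convert hl using 1
  ring_nf

lemma rpow_norm_le_rpow_norm_act {M : Matrix (Fin n) (Fin n) ℝ} (hM : IsUnit M) {x : Rn n}
    (hx : 0 < ‖x‖) (γ : ℝ) :
    ‖x‖ ^ γ ≤ max (matNorm M ^ (-γ)) (matNorm M⁻¹ ^ γ) * ‖act M x‖ ^ γ := by
  have hxy := norm_act_le M⁻¹ (act M x)
  rw [act_inv_act hM] at hxy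
  have hyx := norm_act_le M x
  have hy : 0 < ‖act M x‖ := by
    refine lt_of_le_of_ne (norm_nonneg _) fun h => ?_
    rw [← h, mul_zero] at hxy
    linarith
  rcases le_total 0 γ with h | h
  · calc ‖x‖ ^ γ ≤ (matNorm M⁻¹ * ‖act M x‖) ^ γ := Real.rpow_le_rpow hx.le hxy h
      _ = matNorm M⁻¹ ^ γ * ‖act M x‖ ^ γ := Real.mul_rpow (matNorm_nonneg _) hy.le
      _ ≤ _ := by gcongr; exact le_max_right _ _
  · have hMpos : 0 < matNorm M := by
      refine lt_of_le_of_ne (matNorm_nonneg M) fun h => ?_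
      rw [← h, zero_mul] at hyx
      linarith
    have h1 : (matNorm M * ‖x‖) ^ γ ≤ ‖act M x‖ ^ γ :=
      Real.rpow_le_rpow_of_nonpos hy hyx h
    rw [Real.mul_rpow hMpos.le hx.le] at h1
    calc ‖x‖ ^ γ = matNorm M ^ (-γ) * (matNorm M ^ γ * ‖x‖ ^ γ) := by
          rw [← mul_assoc, ← Real.rpow_add hMpos, neg_add_cancel, Real.rpow_zero, one_mul]
      _ ≤ matNorm M ^ (-γ) * ‖act M x‖ ^ γ := by gcongr
      _ ≤ _ := by gcongr; exact le_max_left _ _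

end Dyadic

/-! ### One function composed with one matrix -/

section OneFunction

variable {n : ℕ} {q α : Rn n → ℝ} {f : Rn n → ℂ} {lam p γ : ℝ}

/-- A single term of the Morrey–Herz norm, in terms of the Luxemburg norm. -/
lemma lpVarNormW_annulus (hq : ∀ x, 0 < q x) (ω : Rn n → ℝ) (hω : ∀ x, 0 ≤ ω x) (k : ℤ) :
    lpVarNormW (fun x => ENNReal.ofReal (q x)) ω
        (fun x => (((2 : ℝ) ^ ((k : ℝ) * α x) : ℝ) : ℂ) * (annulus n k).indicator f x) =
      luxNorm volume q fun x => (annulus n k).indicator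
        (fun x => ENNReal.ofReal ((2 : ℝ) ^ ((k : ℝ) * α x) * ω x) * ‖f x‖ₑ) x := by
  have habs : ∀ c : ℝ, 0 ≤ c → ‖(c : ℂ)‖ₑ = ENNReal.ofReal c := fun c hc => by
    rw [← ofReal_norm, Complex.norm_real, Real.norm_of_nonneg hc]
  rw [lpVarNormW, lpVarNorm_eq_luxNorm hq]
  congr 1
  ext x
  have h2 : (0 : ℝ) ≤ 2 ^ ((k : ℝ) * α x) := (Real.rpow_pos_of_pos two_pos _).le
  by_cases hx : x ∈ annulus n k
  · rw [Set.indicator_of_mem hx, Set.indicator_of_mem hx, enorm_mul, enorm_mul, habs _ h2,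
      habs _ (hω x), ENNReal.ofReal_mul h2]
    ring
  · simp [Set.indicator_of_notMem hx]

/-- Each term of the Morrey–Herz norm grows at most like `2^{kλ}`. -/
lemma luxNorm_annulus_le_morreyHerzNorm (hq : ∀ x, 0 < q x) (ω : Rn n → ℝ) (hω : ∀ x, 0 ≤ ω x)
    (hp : 0 < p) (k : ℤ) :
    luxNorm volume q (fun x => (annulus n k).indicator
        (fun x => ENNReal.ofReal ((2 : ℝ) ^ ((k : ℝ) * α x) * ω x) * ‖f x‖ₑ) x) ≤
      ENNReal.ofReal ((2 : ℝ) ^ ((k : ℝ) * lam)) * morreyHerzNorm α lam p q ω f := by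
  rw [← lpVarNormW_annulus hq ω hω]
  set D : ℤ → ℝ≥0∞ := fun k => lpVarNormW (fun x => ENNReal.ofReal (q x)) ω
        (fun x => (((2 : ℝ) ^ ((k : ℝ) * α x) : ℝ) : ℂ) * (annulus n k).indicator f x) with hD
  change D k ≤ _
  have h1 : D k ≤ (∑' j : Set.Iic k, D j.1 ^ p) ^ (1 / p) := by
    calc D k = (D k ^ p) ^ (1 / p) := by
          rw [← ENNReal.rpow_mul, mul_one_div_cancel hp.ne', ENNReal.rpow_one]
      _ ≤ _ := by
          refine ENNReal.rpow_le_rpow ?_ (by positivity)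
          exact ENNReal.le_tsum (f := fun j : Set.Iic k => D j.1 ^ p) ⟨k, Set.self_mem_Iic⟩
  have h2 : ENNReal.ofReal ((2 : ℝ) ^ (-(k : ℝ) * lam)) *
      (∑' j : Set.Iic k, D j.1 ^ p) ^ (1 / p) ≤ morreyHerzNorm α lam p q ω f :=
    le_iSup (fun k₀ : ℤ => ENNReal.ofReal ((2 : ℝ) ^ (-(k₀ : ℝ) * lam)) *
      (∑' j : Set.Iic k₀, D j.1 ^ p) ^ (1 / p)) k
  have h3 : ENNReal.ofReal ((2 : ℝ) ^ ((k : ℝ) * lam)) *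
      ENNReal.ofReal ((2 : ℝ) ^ (-(k : ℝ) * lam)) = 1 := by
    rw [← ENNReal.ofReal_mul (by positivity), ← Real.rpow_add two_pos]
    simp
  calc D k ≤ 1 * (∑' j : Set.Iic k, D j.1 ^ p) ^ (1 / p) := by rwa [one_mul]
    _ = ENNReal.ofReal ((2 : ℝ) ^ ((k : ℝ) * lam)) *
        (ENNReal.ofReal ((2 : ℝ) ^ (-(k : ℝ) * lam)) *
          (∑' j : Set.Iic k, D j.1 ^ p) ^ (1 / p)) := by rw [← h3, mul_assoc]
    _ ≤ _ := by gcongr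

/-- The norm of `f` on an annulus, without the factor `2^{kα(·)}`. -/
lemma luxNorm_annulus_weight_le (hq : ∀ x, 0 < q x) (hp : 0 < p) {K a₀ ainf : ℝ}
    (hK : ∀ (k : ℤ) (x : Rn n), x ∈ annulus n k →
      |(k : ℝ) * (α x - dyadicValue a₀ ainf k)| ≤ K) (l : ℤ) :
    luxNorm volume q (fun y => (annulus n l).indicator
        (fun y => ENNReal.ofReal (‖y‖ ^ γ) * ‖f y‖ₑ) y) ≤
      ENNReal.ofReal ((2 : ℝ) ^ K * (2 : ℝ) ^ ((l : ℝ) * (lam - dyadicValue a₀ ainf l))) *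
        morreyHerzNorm α lam p q (fun x => ‖x‖ ^ γ) f := by
  set a := dyadicValue a₀ ainf l with ha
  have hpt : ∀ y, (annulus n l).indicator (fun y => ENNReal.ofReal (‖y‖ ^ γ) * ‖f y‖ₑ) y ≤
      ENNReal.ofReal ((2 : ℝ) ^ (K - l * a)) * (annulus n l).indicator
        (fun x => ENNReal.ofReal ((2 : ℝ) ^ ((l : ℝ) * α x) * ‖x‖ ^ γ) * ‖f x‖ₑ) y := by
    intro y
    by_cases hy : y ∈ annulus n l
    · rw [Set.indicator_of_mem hy, Set.indicator_of_mem hy, ← mul_assoc,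
        ← ENNReal.ofReal_mul (by positivity), ← mul_assoc, ← Real.rpow_add two_pos]
      gcongr
      refine le_mul_of_one_le_left (by positivity) (Real.one_le_rpow one_le_two ?_)
      have := (abs_le.1 (hK l y hy)).1
      rw [mul_sub] at this
      linarith
    · simp [Set.indicator_of_notMem hy]
  calc _ ≤ luxNorm volume q (fun y => ENNReal.ofReal ((2 : ℝ) ^ (K - l * a)) *
        (annulus n l).indicator
          (fun x => ENNReal.ofReal ((2 : ℝ) ^ ((l : ℝ) * α x) * ‖x‖ ^ γ) * ‖f x‖ₑ) y) :=
        luxNorm_mono_ae (fun x => (hq x).le) (ae_of_all _ hpt)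
    _ ≤ ENNReal.ofReal ((2 : ℝ) ^ (K - l * a)) * luxNorm volume q (fun y =>
        (annulus n l).indicator
          (fun x => ENNReal.ofReal ((2 : ℝ) ^ ((l : ℝ) * α x) * ‖x‖ ^ γ) * ‖f x‖ₑ) y) :=
        luxNorm_const_mul_le hq ENNReal.ofReal_ne_top
    _ ≤ ENNReal.ofReal ((2 : ℝ) ^ (K - l * a)) * (ENNReal.ofReal ((2 : ℝ) ^ ((l : ℝ) * lam)) *
        morreyHerzNorm α lam p q (fun x => ‖x‖ ^ γ) f) := by
        gcongr
        exact luxNorm_annulus_le_morreyHerzNorm hq _ (fun x => by positivity) hp l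
    _ = _ := by
        rw [← mul_assoc, ← ENNReal.ofReal_mul (by positivity), ← Real.rpow_add two_pos,
          ← Real.rpow_add two_pos]
        ring_nf

/-- The geometric sum over the image annuli is controlled by `phiConst`. -/
lemma sum_rpow_dyadicValue_le {a₀ ainf : ℝ} (h : ainf ≤ a₀) {M : Matrix (Fin n) (Fin n) ℝ}
    {ρ : ℤ} (h1 : (2 : ℝ) ^ ((ρ : ℝ) - 1) < matNorm M) (h2 : matNorm M ≤ (2 : ℝ) ^ (ρ : ℝ))
    (θ k : ℤ) :
    ∑ s ∈ Finset.Icc (θ - 1) 0, (2 : ℝ) ^ ((k : ℝ) * dyadicValue a₀ ainf k) *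
        (2 : ℝ) ^ (((k + (ρ + s) : ℤ) : ℝ) * (lam - dyadicValue a₀ ainf (k + (ρ + s)))) ≤
      2 * (2 : ℝ) ^ (|lam - a₀| + |lam - ainf|) * (2 : ℝ) ^ ((k : ℝ) * lam) *
        phiConst M θ lam a₀ ainf := by
  have hp : ∀ b : ℝ, (0 : ℝ) < 2 ^ b := fun b => Real.rpow_pos_of_pos two_pos b
  have hMpos : 0 < matNorm M := (hp _).trans h1
  set m := max (matNorm M ^ (lam - a₀)) (matNorm M ^ (lam - ainf)) with hm
  set c : ℝ := (2 : ℝ) ^ (|lam - a₀| + |lam - ainf|) with hc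
  have hm0 : 0 < m := lt_max_of_lt_left (Real.rpow_pos_of_pos hMpos _)
  have hρ : ∀ a, a = a₀ ∨ a = ainf → (2 : ℝ) ^ ((ρ : ℝ) * (lam - a)) ≤ c * m := by
    intro a ha
    refine (rpow_two_mul_le h1.le h2 (lam - a)).1.trans ?_
    rcases ha with rfl | rfl
    · gcongr
      · exact Real.rpow_le_rpow_of_exponent_le one_le_two (le_add_of_nonneg_right (abs_nonneg _))
      · exact le_max_left _ _
    · gcongr
      · exact Real.rpow_le_rpow_of_exponent_le one_le_two (le_add_of_nonneg_left (abs_nonneg _))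
      · exact le_max_right _ _
  have hterm : ∀ s : ℤ, (2 : ℝ) ^ ((k : ℝ) * dyadicValue a₀ ainf k) *
        (2 : ℝ) ^ (((k + (ρ + s) : ℤ) : ℝ) * (lam - dyadicValue a₀ ainf (k + (ρ + s)))) ≤
      (2 : ℝ) ^ ((k : ℝ) * lam) * (c * m) *
        ((2 : ℝ) ^ ((s : ℝ) * (lam - a₀)) + (2 : ℝ) ^ ((s : ℝ) * (lam - ainf))) := by
    intro s
    obtain ⟨a, ha, hle⟩ := exists_dyadicValue_exponent_le (lam := lam) h k (ρ + s)
    have hs : (2 : ℝ) ^ ((s : ℝ) * (lam - a)) ≤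
        (2 : ℝ) ^ ((s : ℝ) * (lam - a₀)) + (2 : ℝ) ^ ((s : ℝ) * (lam - ainf)) := by
      rcases ha with rfl | rfl
      · exact le_add_of_nonneg_right (hp _).le
      · exact le_add_of_nonneg_left (hp _).le
    rw [← Real.rpow_add two_pos]
    calc _ ≤ (2 : ℝ) ^ ((k : ℝ) * lam + ((ρ + s : ℤ) : ℝ) * (lam - a)) :=
          Real.rpow_le_rpow_of_exponent_le one_le_two hle
      _ = (2 : ℝ) ^ ((k : ℝ) * lam) * (2 : ℝ) ^ ((ρ : ℝ) * (lam - a)) *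
          (2 : ℝ) ^ ((s : ℝ) * (lam - a)) := by
          rw [← Real.rpow_add two_pos, ← Real.rpow_add two_pos]
          push_cast
          ring_nf
      _ ≤ _ := by
          gcongr
          exact hρ a ha
  calc _ ≤ ∑ s ∈ Finset.Icc (θ - 1) 0, (2 : ℝ) ^ ((k : ℝ) * lam) * (c * m) *
        ((2 : ℝ) ^ ((s : ℝ) * (lam - a₀)) + (2 : ℝ) ^ ((s : ℝ) * (lam - ainf))) :=
        Finset.sum_le_sum fun s _ => hterm s
    _ = (2 : ℝ) ^ ((k : ℝ) * lam) * (c * m) *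
        (∑ s ∈ Finset.Icc (θ - 1) 0, (2 : ℝ) ^ ((s : ℝ) * (lam - a₀)) +
          ∑ s ∈ Finset.Icc (θ - 1) 0, (2 : ℝ) ^ ((s : ℝ) * (lam - ainf))) := by
        rw [← Finset.mul_sum, Finset.sum_add_distrib]
    _ ≤ (2 : ℝ) ^ ((k : ℝ) * lam) * (c * m) *
        (max (∑ s ∈ Finset.Icc (θ - 1) 0, (2 : ℝ) ^ ((s : ℝ) * (lam - a₀)))
          (∑ s ∈ Finset.Icc (θ - 1) 0, (2 : ℝ) ^ ((s : ℝ) * (lam - ainf))) +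
        max (∑ s ∈ Finset.Icc (θ - 1) 0, (2 : ℝ) ^ ((s : ℝ) * (lam - a₀)))
          (∑ s ∈ Finset.Icc (θ - 1) 0, (2 : ℝ) ^ ((s : ℝ) * (lam - ainf)))) := by
        have : 0 < c := hp _
        gcongr
        · exact le_max_left _ _
        · exact le_max_right _ _
    _ = _ := by
        rw [phiConst]
        ring

/-- The bound for one function composed with one matrix, on one annulus. -/
lemma luxNorm_annulus_comp_act_le (hn : 1 ≤ n) (hq : ClassPb q) (hp : 0 < p) {K a₀ ainf : ℝ}
    (h : ainf ≤ a₀)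
    (hK : ∀ (k : ℤ) (x : Rn n), x ∈ annulus n k →
      |(k : ℝ) * (α x - dyadicValue a₀ ainf k)| ≤ K)
    (hf : AEStronglyMeasurable f volume)
    (hfin : morreyHerzNorm α lam p q (fun x => ‖x‖ ^ γ) f ≠ ⊤)
    {M : Matrix (Fin n) (Fin n) ℝ} (hM : IsUnit M) {θ : ℤ}
    (hθ : matNorm M * matNorm M⁻¹ < (2 : ℝ) ^ (-θ))
    (hle : ∀ᵐ x ∂(volume : Measure (Rn n)), q (act M⁻¹ x) ≤ q x)
    (hϑ : thetaNorm 1 q M ≠ ⊤) (k : ℤ) :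
    luxNorm volume q (fun x => (annulus n k).indicator
        (fun x => ENNReal.ofReal ((2 : ℝ) ^ ((k : ℝ) * α x) * ‖x‖ ^ γ) * ‖f (act M x)‖ₑ) x) ≤
      ENNReal.ofReal (4 * (2 : ℝ) ^ (2 * K) * (2 : ℝ) ^ (|lam - a₀| + |lam - ainf|)) *
        ENNReal.ofReal ((2 : ℝ) ^ ((k : ℝ) * lam)) *
        (ENNReal.ofReal (cConst M q γ) * thetaNorm 1 q M *
          ENNReal.ofReal (phiConst M θ lam a₀ ainf)) *
        morreyHerzNorm α lam p q (fun x => ‖x‖ ^ γ) f := by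
  have hq0 : ∀ x, 0 < q x := fun x => by linarith [hq.one_lt x]
  obtain ⟨ρ, h1, h2⟩ := exists_rpow_two_bounds (matNorm_pos hn hM)
  set MH := morreyHerzNorm α lam p q (fun x => ‖x‖ ^ γ) f with hMH
  set w : ℝ := max (matNorm M ^ (-γ)) (matNorm M⁻¹ ^ γ) with hw
  have hw0 : 0 ≤ w := le_max_of_le_left (Real.rpow_nonneg (matNorm_nonneg _) _)
  set D : ℝ := max (|M⁻¹.det| ^ (1 / expSup q)) (|M⁻¹.det| ^ (1 / expInf q)) with hD
  set g : ℤ → Rn n → ℝ≥0∞ := fun l y =>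
    (annulus n l).indicator (fun y => ENNReal.ofReal (‖y‖ ^ γ) * ‖f y‖ₑ) y with hg
  have hgm : ∀ l, AEMeasurable (g l) volume := fun l =>
    (((measurable_norm.pow_const γ).ennreal_ofReal.aemeasurable).mul hf.enorm).indicator
      (measurableSet_annulus l)
  set c₁ : ℝ := (2 : ℝ) ^ K * (2 : ℝ) ^ ((k : ℝ) * dyadicValue a₀ ainf k) * w with hc₁
  have hc₁0 : 0 ≤ c₁ := by positivity
  set J := Finset.Icc (θ - 1) 0 with hJ
  have hpt : ∀ x, (annulus n k).indicator
        (fun x => ENNReal.ofReal ((2 : ℝ) ^ ((k : ℝ) * α x) * ‖x‖ ^ γ) * ‖f (act M x)‖ₑ) x ≤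
      ENNReal.ofReal c₁ * ∑ s ∈ J, g (k + (ρ + s)) (act M x) := by
    intro x
    by_cases hx : x ∈ annulus n k
    · obtain ⟨s, hs, hsx⟩ := exists_act_mem_annulus hM h1 h2 hθ hx
      rw [Set.indicator_of_mem hx]
      have hterm : ENNReal.ofReal (‖act M x‖ ^ γ) * ‖f (act M x)‖ₑ ≤
          ∑ s ∈ J, g (k + (ρ + s)) (act M x) := by
        refine le_trans (le_of_eq ?_) (Finset.single_le_sum
          (f := fun s => g (k + (ρ + s)) (act M x)) (fun _ _ => zero_le) hs)
        simp only [hg]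
        rw [Set.indicator_of_mem hsx]
      refine le_trans ?_ (mul_le_mul_right hterm _)
      rw [← mul_assoc, ← ENNReal.ofReal_mul hc₁0]
      refine mul_le_mul_left (ENNReal.ofReal_le_ofReal ?_) _
      have hα : (2 : ℝ) ^ ((k : ℝ) * α x) ≤
          (2 : ℝ) ^ K * (2 : ℝ) ^ ((k : ℝ) * dyadicValue a₀ ainf k) := by
        rw [← Real.rpow_add two_pos]
        refine Real.rpow_le_rpow_of_exponent_le one_le_two ?_
        have := (abs_le.1 (hK k x hx)).2
        rw [mul_sub] at this
        linarith
      calc _ ≤ (2 : ℝ) ^ K * (2 : ℝ) ^ ((k : ℝ) * dyadicValue a₀ ainf k) *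
            (w * ‖act M x‖ ^ γ) := by
            exact mul_le_mul hα
              (rpow_norm_le_rpow_norm_act hM (norm_pos_of_mem_annulus hx) γ) (by positivity)
              (by positivity)
        _ = _ := by rw [hc₁]; ring
    · simp [Set.indicator_of_notMem hx]
  have hgl : ∀ l : ℤ, luxNorm volume q (g l) ≤
      ENNReal.ofReal ((2 : ℝ) ^ K * (2 : ℝ) ^ ((l : ℝ) * (lam - dyadicValue a₀ ainf l))) * MH :=
    fun l => luxNorm_annulus_weight_le hq0 hp hK l
  have hcomp : ∀ l : ℤ, luxNorm volume q (fun x => g l (act M x)) ≤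
      ENNReal.ofReal D * (2 * (thetaNorm 1 q M * (ENNReal.ofReal ((2 : ℝ) ^ K *
        (2 : ℝ) ^ ((l : ℝ) * (lam - dyadicValue a₀ ainf l))) * MH))) := by
    intro l
    refine (luxNorm_comp_act_le hq hM (g l)).trans ?_
    gcongr
    refine (luxNorm_act_inv_exponent_le hq hle (hgm l) ?_ hϑ).trans ?_
    · exact ne_top_of_le_ne_top (ENNReal.mul_ne_top ENNReal.ofReal_ne_top hfin) (hgl l)
    · gcongr
      exact hgl l
  have hsum : ENNReal.ofReal c₁ * ∑ s ∈ J, ENNReal.ofReal ((2 : ℝ) ^ K *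
        (2 : ℝ) ^ (((k + (ρ + s) : ℤ) : ℝ) * (lam - dyadicValue a₀ ainf (k + (ρ + s))))) ≤
      ENNReal.ofReal (2 * (2 : ℝ) ^ (2 * K) * (2 : ℝ) ^ (|lam - a₀| + |lam - ainf|)) *
        ENNReal.ofReal ((2 : ℝ) ^ ((k : ℝ) * lam)) * ENNReal.ofReal w *
          ENNReal.ofReal (phiConst M θ lam a₀ ainf) := by
    rw [← ENNReal.ofReal_sum_of_nonneg (fun s _ => by positivity), ← ENNReal.ofReal_mul hc₁0,
      ← ENNReal.ofReal_mul (by positivity), ← ENNReal.ofReal_mul (by positivity),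
      ← ENNReal.ofReal_mul (by positivity)]
    refine ENNReal.ofReal_le_ofReal ?_
    have := sum_rpow_dyadicValue_le (lam := lam) h h1 h2 θ k
    rw [← Finset.mul_sum] at this
    have h2K : (2 : ℝ) ^ (2 * K) = (2 : ℝ) ^ K * (2 : ℝ) ^ K := by
      rw [← Real.rpow_add two_pos]; ring_nf
    rw [← Finset.mul_sum, hc₁, h2K]
    calc _ = (2 : ℝ) ^ K * (2 : ℝ) ^ K * w * _ := by ring
      _ ≤ (2 : ℝ) ^ K * (2 : ℝ) ^ K * w * _ :=
        mul_le_mul_of_nonneg_left this (by positivity)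
      _ = _ := by ring
  calc _ ≤ luxNorm volume q (fun x => ENNReal.ofReal c₁ *
        ∑ s ∈ J, g (k + (ρ + s)) (act M x)) :=
        luxNorm_mono_ae (fun x => (hq0 x).le) (ae_of_all _ hpt)
    _ ≤ ENNReal.ofReal c₁ * luxNorm volume q (fun x =>
        ∑ s ∈ J, g (k + (ρ + s)) (act M x)) :=
        luxNorm_const_mul_le hq0 ENNReal.ofReal_ne_top
    _ ≤ ENNReal.ofReal c₁ * ∑ s ∈ J, luxNorm volume q (fun x => g (k + (ρ + s)) (act M x)) := by
        gcongr
        exact luxNorm_sum_le J hq.one_lt hq.1 (F := fun s x => g (k + (ρ + s)) (act M x))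
          fun s => (hgm _).comp_quasiMeasurePreserving (quasiMeasurePreserving_act hM)
    _ ≤ ENNReal.ofReal c₁ * ∑ s ∈ J, ENNReal.ofReal D * (2 * (thetaNorm 1 q M *
        (ENNReal.ofReal ((2 : ℝ) ^ K * (2 : ℝ) ^ (((k + (ρ + s) : ℤ) : ℝ) *
          (lam - dyadicValue a₀ ainf (k + (ρ + s))))) * MH))) := by
        gcongr
        exact hcomp _
    _ = ENNReal.ofReal D * (2 * thetaNorm 1 q M * MH) *
        (ENNReal.ofReal c₁ * ∑ s ∈ J, ENNReal.ofReal ((2 : ℝ) ^ K *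
        (2 : ℝ) ^ (((k + (ρ + s) : ℤ) : ℝ) * (lam - dyadicValue a₀ ainf (k + (ρ + s)))))) := by
        rw [Finset.mul_sum, Finset.mul_sum, Finset.mul_sum]
        exact Finset.sum_congr rfl fun s _ => by ring
    _ ≤ _ := mul_le_mul_right hsum _
    _ = _ := by
        have e4 : ENNReal.ofReal
            (4 * (2 : ℝ) ^ (2 * K) * (2 : ℝ) ^ (|lam - a₀| + |lam - ainf|)) =
            2 * ENNReal.ofReal
              (2 * (2 : ℝ) ^ (2 * K) * (2 : ℝ) ^ (|lam - a₀| + |lam - ainf|)) := by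
          rw [← ENNReal.ofReal_ofNat 2, ← ENNReal.ofReal_mul zero_le_two]
          ring_nf
        rw [e4, cConst, ENNReal.ofReal_mul hw0]
        ring

end OneFunction

/-! ### Hölder's inequality for the target exponent -/

section Holder

variable {n m : ℕ}

lemma recip_nonneg (r : ℝ≥0∞) : 0 ≤ recip r := ENNReal.toReal_nonneg

lemma recip_le_one {r : ℝ≥0∞} (hr : 1 ≤ r) : recip r ≤ 1 := by
  rw [recip, ← ENNReal.toReal_one]
  exact ENNReal.toReal_mono ENNReal.one_ne_top (ENNReal.inv_le_one.2 hr)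

lemma volume_annulus_le (k : ℤ) :
    ENNReal.ofReal ((2 : ℝ) ^ (-(k : ℝ) * n)) * volume (annulus n k) ≤
      volume (Metric.closedBall (0 : Rn n) 1) := by
  have h1 : volume (annulus n k) ≤
      ENNReal.ofReal ((2 : ℝ) ^ ((k : ℝ) * n)) * volume (Metric.closedBall (0 : Rn n) 1) := by
    refine (measure_mono Set.sdiff_subset).trans (le_of_eq ?_)
    rw [Measure.addHaar_closedBall' _ _ (by positivity), finrank_euclideanSpace, Fintype.card_fin,
      Real.rpow_mul two_pos.le, Real.rpow_intCast, Real.rpow_natCast]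
  refine (mul_le_mul_right h1 _).trans (le_of_eq ?_)
  rw [← mul_assoc, ← ENNReal.ofReal_mul (by positivity), ← Real.rpow_add two_pos]
  simp

/-- Hölder's inequality on an annulus. The factor `2^{-kn / r_i(x)}` has modular
`2^{-kn} |C_k|` for the exponent `r_i`, which is independent of `k`. -/
lemma luxNorm_annulus_prod_le {q : Fin m → Rn n → ℝ} {r : Fin m → Rn n → ℝ≥0∞}
    (hq : ∀ i x, 1 < q i x) (hqm : ∀ i, AEMeasurable (q i) volume)
    (hqt : ∀ x, 1 < targetExponent q r x)
    {a : Fin m → Rn n → ℝ≥0∞} (ha : ∀ i, AEMeasurable (a i) volume)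
    (hfin : ∀ i, luxNorm volume (q i) (a i) ≠ ⊤) (k : ℤ) :
    luxNorm volume (targetExponent q r) (fun x => (annulus n k).indicator (fun x =>
        (∏ i, a i x) * ∏ i, ENNReal.ofReal ((2 : ℝ) ^ (-(k : ℝ) * n)) ^ recip (r i x)) x) ≤
      ENNReal.ofReal (1 + m + m * (volume (Metric.closedBall (0 : Rn n) 1)).toReal) *
        ∏ i, luxNorm volume (q i) (a i) := by
  refine le_const_mul_prod_of_forall_lt hfin ENNReal.ofReal_ne_top fun η hη => ?_
  set V := volume (Metric.closedBall (0 : Rn n) 1) with hV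
  have hVtop : V ≠ ⊤ := measure_closedBall_lt_top.ne
  set Z : ℝ≥0∞ := ENNReal.ofReal ((2 : ℝ) ^ (-(k : ℝ) * n)) with hZ
  set Q := targetExponent q r with hQ
  have hηprod : 0 < ∏ i, η i := Finset.prod_pos fun i _ => (hη i).1
  have hpt : ∀ x, ((annulus n k).indicator (fun x =>
      (∏ i, a i x) * ∏ i, Z ^ recip (r i x)) x / ENNReal.ofReal (∏ i, η i)) ^ Q x ≤
      ∑ i, (a i x / ENNReal.ofReal (η i)) ^ q i x +
        (annulus n k).indicator (fun _ => m * Z) x := by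
    intro x
    have hQx := hqt x
    by_cases hx : x ∈ annulus n k
    · rw [Set.indicator_of_mem hx, Set.indicator_of_mem hx,
        ENNReal.ofReal_prod_of_nonneg fun i _ => (hη i).1.le, mul_comm, mul_div_assoc,
        ← ENNReal.prod_div_distrib_of_ne_top (fun _ _ => ENNReal.ofReal_ne_top), mul_comm,
        ENNReal.mul_rpow_of_nonneg _ _ (by linarith),
        ← ENNReal.prod_rpow_of_nonneg (by linarith), ← ENNReal.prod_rpow_of_nonneg (by linarith)]
      have hsum : ∑ j : Fin m ⊕ Fin m,
          Sum.elim (fun i => Q x / q i x) (fun i => recip (r i x) * Q x) j = 1 := by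
        rw [Fintype.sum_sum_type]
        simp only [Sum.elim_inl, Sum.elim_inr]
        rw [← Finset.sum_mul]
        have e : ∑ i, Q x / q i x = (∑ i, 1 / q i x) * Q x := by
          rw [Finset.sum_mul]
          exact Finset.sum_congr rfl fun i _ => by ring
        rw [e, ← add_mul]
        have hS : ∑ i, 1 / q i x + ∑ i, recip (r i x) ≠ 0 := by
          intro h0
          have : Q x = 0 := by rw [hQ, targetExponent, h0, div_zero]
          linarith
        rw [hQ, targetExponent]
        exact mul_one_div_cancel hS
      have := prod_rpow_le_sum (Finset.univ : Finset (Fin m ⊕ Fin m))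
        (Sum.elim (fun i => (a i x / ENNReal.ofReal (η i)) ^ q i x) (fun _ => Z))
        (Sum.elim (fun i => Q x / q i x) (fun i => recip (r i x) * Q x)) ?_ hsum
      · rw [Fintype.prod_sum_type, Fintype.sum_sum_type] at this
        simp only [Sum.elim_inl, Sum.elim_inr, Finset.sum_const, Finset.card_univ,
          Fintype.card_fin, nsmul_eq_mul] at this
        refine le_trans (le_of_eq ?_) this
        congr 1
        · refine Finset.prod_congr rfl fun i _ => ?_
          rw [← ENNReal.rpow_mul, mul_div_cancel₀ _ (by linarith [hq i x])]
        · exact Finset.prod_congr rfl fun i _ => by rw [← ENNReal.rpow_mul]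
      · rintro (i | i) -
        · exact div_nonneg (by linarith) (by linarith [hq i x])
        · exact mul_nonneg (recip_nonneg _) (by linarith)
    · rw [Set.indicator_of_notMem hx, ENNReal.zero_div, ENNReal.zero_rpow_of_pos (by linarith)]
      exact zero_le
  have hmod : emodular volume Q (fun x => (annulus n k).indicator (fun x =>
      (∏ i, a i x) * ∏ i, Z ^ recip (r i x)) x / ENNReal.ofReal (∏ i, η i)) ≤
      ENNReal.ofReal (1 + m + m * V.toReal) := by
    calc _ ≤ ∫⁻ x, (∑ i, (a i x / ENNReal.ofReal (η i)) ^ q i x +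
          (annulus n k).indicator (fun _ => m * Z) x) := lintegral_mono hpt
      _ = ∑ i, emodular volume (q i) (fun x => a i x / ENNReal.ofReal (η i)) +
          m * Z * volume (annulus n k) := by
          rw [lintegral_add_right _ (measurable_const.indicator (measurableSet_annulus k)),
            lintegral_finsetSum' _ fun i _ => ((ha i).div_const _).pow (hqm i),
            lintegral_indicator_const (measurableSet_annulus k)]
          rfl
      _ ≤ ∑ _i : Fin m, 1 + m * V := by
          rw [mul_assoc]
          gcongr with i _
          · exact emodular_le_one_of_luxNorm_lt (fun x => by linarith [hq i x]) (hη i).2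
          · exact volume_annulus_le k
      _ ≤ _ := by
          rw [ENNReal.ofReal_add (by positivity) (by positivity),
            ENNReal.ofReal_add (by positivity) (by positivity),
            ENNReal.ofReal_mul (by positivity), ENNReal.ofReal_natCast,
            ENNReal.ofReal_toReal hVtop]
          simp only [Finset.sum_const, Finset.card_univ, Fintype.card_fin, nsmul_eq_mul, mul_one]
          gcongr
          exact le_add_self
  refine (luxNorm_le_mul_of_emodular_le (fun x => (hqt x).le) hηprod ?_ hmod).trans (le_of_eq ?_)
  · have : (0 : ℝ) ≤ m + m * V.toReal := by positivity
    linarith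
  · rw [ENNReal.ofReal_mul (by positivity), ENNReal.ofReal_prod_of_nonneg fun i _ => (hη i).1.le]

end Holder

/-! ### The integrand for a fixed value of the integration variable -/

section FixedParameter

variable {n m : ℕ}

/-- The weights of the target space split into factors belonging to the individual functions. The
powers of `2^k` coming from `α^*` and from the variable part of the weight leave `2^{-kn/r_i}`. -/
lemma target_weight_le {α : Fin m → Rn n → ℝ} {β : Fin m → ℝ≥0} {γ : Fin m → ℝ}
    {r : Fin m → Rn n → ℝ≥0∞} (hr : ∀ i x, 1 ≤ r i x) {k : ℤ} {x : Rn n}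
    (hx : x ∈ annulus n k) :
    (2 : ℝ) ^ ((k : ℝ) * targetAlpha α β γ r x) * ‖x‖ ^ targetGamma γ r x ≤
      ∏ i, ((2 : ℝ) ^ ((k : ℝ) * α i x) * ‖x‖ ^ γ i * (2 : ℝ) ^ (-((k : ℝ) * β i)) *
        (2 : ℝ) ^ |γ i| * ((2 : ℝ) ^ (-(k : ℝ) * n)) ^ recip (r i x)) := by
  have hxpos := norm_pos_of_mem_annulus hx
  obtain ⟨hx1, hx2⟩ := mem_annulus_iff.1 hx
  have e1 : (2 : ℝ) ^ ((k : ℝ) * targetAlpha α β γ r x) * ‖x‖ ^ targetGamma γ r x =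
      ∏ i, ((2 : ℝ) ^ ((k : ℝ) * α i x - (k : ℝ) * β i - (k : ℝ) * ((γ i + n) * recip (r i x))) *
        (‖x‖ ^ (γ i + γ i * recip (r i x)))) := by
    rw [Finset.prod_mul_distrib, ← Real.rpow_sum_of_pos two_pos, ← Real.rpow_sum_of_pos hxpos]
    congr 2
    · rw [targetAlpha, Finset.sum_sub_distrib, Finset.sum_sub_distrib, ← Finset.mul_sum,
        ← Finset.mul_sum, ← Finset.mul_sum]
      ring
    · rw [targetGamma, Finset.sum_add_distrib]
  rw [e1]
  refine Finset.prod_le_prod (fun i _ => by positivity) fun i _ => ?_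
  set ρ := recip (r i x) with hρ
  have hρ0 : 0 ≤ ρ := recip_nonneg _
  have hρ1 : ρ ≤ 1 := recip_le_one (hr i x)
  have hw : ‖x‖ ^ (γ i * ρ) ≤ (2 : ℝ) ^ |γ i| * (2 : ℝ) ^ ((k : ℝ) * (γ i * ρ)) := by
    refine (rpow_two_mul_le hx1.le hx2 (γ i * ρ)).2.trans ?_
    refine mul_le_mul_of_nonneg_right (Real.rpow_le_rpow_of_exponent_le one_le_two ?_)
      (Real.rpow_pos_of_pos two_pos _).le
    rw [abs_mul, abs_of_nonneg hρ0]
    exact mul_le_of_le_one_right (abs_nonneg _) hρ1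
  rw [Real.rpow_add hxpos]
  calc _ ≤ (2 : ℝ) ^ ((k : ℝ) * α i x - (k : ℝ) * β i - (k : ℝ) * ((γ i + n) * ρ)) *
        (‖x‖ ^ γ i * ((2 : ℝ) ^ |γ i| * (2 : ℝ) ^ ((k : ℝ) * (γ i * ρ)))) := by gcongr
    _ = _ := by
      have e2 : (k : ℝ) * α i x - (k : ℝ) * β i - (k : ℝ) * ((γ i + n) * ρ) =
          (k : ℝ) * α i x + -((k : ℝ) * β i) + -(k : ℝ) * n * ρ + -((k : ℝ) * (γ i * ρ)) := by
        ring
      rw [e2, Real.rpow_add two_pos, Real.rpow_add two_pos, Real.rpow_add two_pos,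
        ← Real.rpow_mul two_pos.le, Real.rpow_neg two_pos.le ((k : ℝ) * (γ i * ρ))]
      have h0 : (2 : ℝ) ^ ((k : ℝ) * (γ i * ρ)) ≠ 0 := (Real.rpow_pos_of_pos two_pos _).ne'
      field_simp

/-- A Hölder function varies on `C_k` between `x` and `M x` by at most a multiple of
`2^{kβ} ‖I - M‖^β`. -/
lemma enorm_sub_act_le {b : Rn n → ℂ} {L β : ℝ≥0} (hb : HolderWith L β b)
    (M : Matrix (Fin n) (Fin n) ℝ) {k : ℤ} {x : Rn n} (hx : x ∈ annulus n k) :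
    ‖b x - b (act M x)‖ₑ ≤
      ENNReal.ofReal (L * matNorm (1 - M) ^ (β : ℝ) * (2 : ℝ) ^ ((k : ℝ) * β)) := by
  rw [← ofReal_norm, ← dist_eq_norm]
  refine ENNReal.ofReal_le_ofReal ((hb.dist_le x (act M x)).trans ?_)
  have hsub : dist x (act M x) ≤ matNorm (1 - M) * (2 : ℝ) ^ (k : ℝ) := by
    have e : x - act M x = act (1 - M) x := by
      simp [act, Matrix.sub_mulVec]
    rw [dist_eq_norm, e]
    exact (norm_act_le _ _).trans
      (mul_le_mul_of_nonneg_left (mem_annulus_iff.1 hx).2 (matNorm_nonneg _))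
  rw [mul_assoc, Real.rpow_mul two_pos.le, ← Real.mul_rpow (matNorm_nonneg _) (by positivity)]
  gcongr

/-- The norm of the weighted integrand on an annulus for a fixed integration variable `t`. The
constant depends on neither the annulus nor `t` nor the functions. -/
lemma exists_luxNorm_commutatorIntegrand_le (hn : 1 ≤ n)
    {γ lam p : Fin m → ℝ} (hp : ∀ i, 0 < p i) {β : Fin m → ℝ≥0}
    {q : Fin m → Rn n → ℝ} (hq : ∀ i, ClassPb (q i))
    {r : Fin m → Rn n → ℝ≥0∞} (hr : ∀ i x, 1 ≤ r i x)
    (hqt : ∀ x, 1 < targetExponent q r x)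
    {α : Fin m → Rn n → ℝ} {αinf : Fin m → ℝ} (hαm : ∀ i, AEMeasurable (α i) volume)
    (hα_zero : ∀ i, LogHolderAtZero (α i)) (hα_inf : ∀ i, LogHolderAtInfty (α i) (αinf i))
    (hα_sign : ∀ i, 0 ≤ α i 0 - αinf i)
    {b : Fin m → Rn n → ℂ} (hb : ∀ i, MemHolder (β i) (b i))
    (Φ : Rn n → ℝ) (A : Fin m → Rn n → Matrix (Fin n) (Fin n) ℝ) :
    ∃ C₀ : ℝ≥0, ∀ (f : Fin m → Rn n → ℂ), (∀ i, AEStronglyMeasurable (f i) volume) →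
      (∀ i, morreyHerzNorm (α i) (lam i) (p i) (q i) (fun x => ‖x‖ ^ γ i) (f i) ≠ ⊤) →
      ∀ (k : ℤ) (t : Rn n) (θ : ℤ), 0 ≤ Φ t → (∀ i, IsUnit (A i t)) →
      (∀ i, matNorm (A i t) * matNorm (A i t)⁻¹ < (2 : ℝ) ^ (-θ)) →
      (∀ i, ∀ᵐ x ∂(volume : Measure (Rn n)), q i (act (A i t)⁻¹ x) ≤ q i x) →
      (∀ i, thetaNorm 1 (q i) (A i t) ≠ ⊤) →
      luxNorm volume (targetExponent q r) (fun x => (annulus n k).indicator (fun x =>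
        ENNReal.ofReal ((2 : ℝ) ^ ((k : ℝ) * targetAlpha α β γ r x) * ‖x‖ ^ targetGamma γ r x) *
          ‖commutatorIntegrand Φ A b f x t‖ₑ) x) ≤
      C₀ * ENNReal.ofReal ((2 : ℝ) ^ ((k : ℝ) * ∑ i, lam i)) *
        (∏ i, morreyHerzNorm (α i) (lam i) (p i) (q i) (fun x => ‖x‖ ^ γ i) (f i)) *
        (ENNReal.ofReal (Φ t / ‖t‖ ^ n) *
          ∏ i, (ENNReal.ofReal (cConst (A i t) (q i) (γ i)) *
            ENNReal.ofReal (matNorm (1 - A i t) ^ (β i : ℝ)) *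
            thetaNorm 1 (q i) (A i t) *
            ENNReal.ofReal (phiConst (A i t) θ (lam i) (α i 0) (αinf i)))) := by
  choose L hL using hb
  choose K hK0 hK using fun i => exists_abs_mul_sub_dyadicValue_le (hα_zero i) (hα_inf i)
  set cH : ℝ := 1 + m + m * (volume (Metric.closedBall (0 : Rn n) 1)).toReal with hcH
  set cF : Fin m → ℝ := fun i =>
    4 * (2 : ℝ) ^ (2 * K i) * (2 : ℝ) ^ (|lam i - α i 0| + |lam i - αinf i|) with hcF
  set cL : Fin m → ℝ := fun i => L i * (2 : ℝ) ^ |γ i| with hcL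
  have hcL0 : ∀ i, 0 ≤ cL i := fun i => by positivity
  refine ⟨cH.toNNReal * ∏ i, ((cL i).toNNReal * (cF i).toNNReal),
    fun f hf hfin k t θ hΦ hA hθ hle hϑ => ?_⟩
  have hqt0 : ∀ x, 0 < targetExponent q r x := fun x => by linarith [hqt x]
  set MH : Fin m → ℝ≥0∞ := fun i =>
    morreyHerzNorm (α i) (lam i) (p i) (q i) (fun x => ‖x‖ ^ γ i) (f i) with hMH
  set a : Fin m → Rn n → ℝ≥0∞ := fun i x => (annulus n k).indicator
    (fun x => ENNReal.ofReal ((2 : ℝ) ^ ((k : ℝ) * α i x) * ‖x‖ ^ γ i) * ‖f i (act (A i t) x)‖ₑ) x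
    with ha
  have ham : ∀ i, AEMeasurable (a i) volume := by
    intro i
    have h1 : AEMeasurable (fun x => (2 : ℝ) ^ ((k : ℝ) * α i x)) volume :=
      aemeasurable_const.pow ((hαm i).const_mul _)
    have h2 : AEMeasurable (fun x : Rn n => ‖x‖ ^ γ i) volume :=
      (measurable_norm.pow_const _).aemeasurable
    have h3 : AEMeasurable (fun x => ‖f i (act (A i t) x)‖ₑ) volume :=
      ((hf i).comp_quasiMeasurePreserving (quasiMeasurePreserving_act (hA i))).enorm
    exact ((h1.mul h2).ennreal_ofReal.mul h3).indicator (measurableSet_annulus k)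
  have hane : ∀ i, luxNorm volume (q i) (a i) ≤ ENNReal.ofReal (cF i) *
        ENNReal.ofReal ((2 : ℝ) ^ ((k : ℝ) * lam i)) *
        (ENNReal.ofReal (cConst (A i t) (q i) (γ i)) * thetaNorm 1 (q i) (A i t) *
          ENNReal.ofReal (phiConst (A i t) θ (lam i) (α i 0) (αinf i))) * MH i := fun i =>
    luxNorm_annulus_comp_act_le hn (hq i) (hp i) (by linarith [hα_sign i]) (hK i) (hf i)
      (hfin i) (hA i) (hθ i) (hle i) (hϑ i) k
  have hatop : ∀ i, luxNorm volume (q i) (a i) ≠ ⊤ := by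
    intro i
    refine ne_top_of_le_ne_top ?_ (hane i)
    refine ENNReal.mul_ne_top (ENNReal.mul_ne_top (ENNReal.mul_ne_top ENNReal.ofReal_ne_top
      ENNReal.ofReal_ne_top) (ENNReal.mul_ne_top (ENNReal.mul_ne_top ENNReal.ofReal_ne_top (hϑ i))
      ENNReal.ofReal_ne_top)) (hfin i)
  set c : ℝ≥0∞ := ENNReal.ofReal (Φ t / ‖t‖ ^ n) *
    ∏ i, ENNReal.ofReal (cL i * matNorm (1 - A i t) ^ (β i : ℝ)) with hc
  have hctop : c ≠ ⊤ := ENNReal.mul_ne_top ENNReal.ofReal_ne_top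
    (ENNReal.prod_ne_top fun i _ => ENNReal.ofReal_ne_top)
  have hpt : ∀ x, (annulus n k).indicator (fun x =>
        ENNReal.ofReal ((2 : ℝ) ^ ((k : ℝ) * targetAlpha α β γ r x) * ‖x‖ ^ targetGamma γ r x) *
          ‖commutatorIntegrand Φ A b f x t‖ₑ) x ≤
      c * (annulus n k).indicator (fun x => (∏ i, a i x) *
        ∏ i, ENNReal.ofReal ((2 : ℝ) ^ (-(k : ℝ) * n)) ^ recip (r i x)) x := by
    intro x
    by_cases hx : x ∈ annulus n k
    · rw [Set.indicator_of_mem hx, Set.indicator_of_mem hx]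
      have hΦ' : ‖((Φ t / ‖t‖ ^ n : ℝ) : ℂ)‖ₑ = ENNReal.ofReal (Φ t / ‖t‖ ^ n) := by
        rw [← ofReal_norm, Complex.norm_real, Real.norm_of_nonneg (by positivity)]
      have hprod : ∀ z : Fin m → ℂ, ‖∏ i, z i‖ₑ = ∏ i, ‖z i‖ₑ := fun z => by
        simp only [← ofReal_norm, norm_prod]
        exact ENNReal.ofReal_prod_of_nonneg fun i _ => norm_nonneg _
      rw [commutatorIntegrand, enorm_mul, enorm_mul, hΦ', hprod, hprod]
      have hw := ENNReal.ofReal_le_ofReal (target_weight_le (α := α) (β := β) (γ := γ) hr hx)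
      rw [ENNReal.ofReal_prod_of_nonneg fun i _ => by positivity] at hw
      refine (mul_le_mul_left hw _).trans ?_
      have hcomm : ∀ W φ X Y : ℝ≥0∞, W * (φ * X * Y) = φ * (X * Y * W) := fun W φ X Y => by ring
      rw [hc, hcomm, mul_assoc _ (∏ i, ENNReal.ofReal (cL i * _))]
      refine mul_le_mul_right ?_ _
      rw [← Finset.prod_mul_distrib, ← Finset.prod_mul_distrib, ← Finset.prod_mul_distrib,
        ← Finset.prod_mul_distrib]
      refine Finset.prod_le_prod' fun i _ => ?_
      have hbi : ∀ W : ℝ≥0∞,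
          ‖f i (act (A i t) x)‖ₑ * ‖b i x - b i (act (A i t) x)‖ₑ * W ≤
            ‖f i (act (A i t) x)‖ₑ * ENNReal.ofReal
              (L i * matNorm (1 - A i t) ^ (β i : ℝ) * (2 : ℝ) ^ ((k : ℝ) * β i)) * W := fun W =>
        mul_le_mul_left (mul_le_mul_right (enorm_sub_act_le (hL i) (A i t) hx) _) W
      refine (hbi _).trans ?_
      simp only [ha]
      rw [Set.indicator_of_mem hx, ENNReal.ofReal_rpow_of_pos (Real.rpow_pos_of_pos two_pos _)]
      have h0 := matNorm_nonneg (1 - A i t)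
      have hcancel : (2 : ℝ) ^ (-((k : ℝ) * β i)) * (2 : ℝ) ^ ((k : ℝ) * β i) = 1 := by
        rw [← Real.rpow_add two_pos, neg_add_cancel, Real.rpow_zero]
      set N := matNorm (1 - A i t) ^ (β i : ℝ) with hN
      have hN0 : 0 ≤ N := Real.rpow_nonneg h0 _
      set B := (2 : ℝ) ^ ((k : ℝ) * β i) with hB
      set B' := (2 : ℝ) ^ (-((k : ℝ) * β i)) with hB'
      set P := (2 : ℝ) ^ ((k : ℝ) * α i x) * ‖x‖ ^ γ i with hP
      set R := ((2 : ℝ) ^ (-(k : ℝ) * n)) ^ recip (r i x) with hR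
      have hR0 : 0 ≤ R := by positivity
      have hP0 : 0 ≤ P := by positivity
      have hBB : 0 ≤ B' := by positivity
      have hBB' : 0 ≤ B := by positivity
      apply le_of_eq
      calc ‖f i (act (A i t) x)‖ₑ * ENNReal.ofReal (L i * N * B) *
            ENNReal.ofReal (P * B' * (2 : ℝ) ^ |γ i| * R)
          = ‖f i (act (A i t) x)‖ₑ * ENNReal.ofReal
              (L i * N * B * (P * B' * (2 : ℝ) ^ |γ i| * R)) := by
            rw [mul_assoc, ← ENNReal.ofReal_mul (by positivity)]
        _ = ‖f i (act (A i t) x)‖ₑ * ENNReal.ofReal (cL i * N * (P * R)) := by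
            congr 2
            simp only [hcL]
            linear_combination (L i * N * P * (2 : ℝ) ^ |γ i| * R) * hcancel
        _ = _ := by
            rw [ENNReal.ofReal_mul (mul_nonneg (hcL0 i) hN0), ENNReal.ofReal_mul hP0]
            ring
    · simp [Set.indicator_of_notMem hx]
  have hlux : luxNorm volume (targetExponent q r) (fun x => (annulus n k).indicator (fun x =>
        ENNReal.ofReal ((2 : ℝ) ^ ((k : ℝ) * targetAlpha α β γ r x) * ‖x‖ ^ targetGamma γ r x) *
          ‖commutatorIntegrand Φ A b f x t‖ₑ) x) ≤
      c * (ENNReal.ofReal cH * ∏ i, luxNorm volume (q i) (a i)) := by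
    refine (luxNorm_mono_ae (fun x => (hqt0 x).le) (ae_of_all _ hpt)).trans ?_
    refine (luxNorm_const_mul_le hqt0 hctop).trans (mul_le_mul_right ?_ _)
    exact luxNorm_annulus_prod_le (fun i => (hq i).one_lt) (fun i => (hq i).1) hqt ham hatop k
  refine hlux.trans ((mul_le_mul_right (mul_le_mul_right
    (Finset.prod_le_prod' fun i _ => hane i) _) _).trans (le_of_eq ?_))
  have h2 : ENNReal.ofReal ((2 : ℝ) ^ ((k : ℝ) * ∑ i, lam i)) =
      ∏ i, ENNReal.ofReal ((2 : ℝ) ^ ((k : ℝ) * lam i)) := by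
    rw [Finset.mul_sum, Real.rpow_sum_of_pos two_pos,
      ENNReal.ofReal_prod_of_nonneg fun i _ => by positivity]
  have h3 : ((cH.toNNReal * ∏ i, ((cL i).toNNReal * (cF i).toNNReal) : ℝ≥0) : ℝ≥0∞) =
      ENNReal.ofReal cH * ∏ i, (ENNReal.ofReal (cL i) * ENNReal.ofReal (cF i)) := by
    push_cast
    rfl
  rw [h2, h3, hc]
  simp only [ENNReal.ofReal_mul (hcL0 _), Finset.prod_mul_distrib]
  ring

end FixedParameter

/-! ### Joint measurability of the integrand -/

section Measurability

variable {n m : ℕ}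

lemma measurable_act {B : Rn n → Matrix (Fin n) (Fin n) ℝ}
    (hB : ∀ j k, Measurable fun t => B t j k) :
    Measurable fun z : Rn n × Rn n => act (B z.1) z.2 := by
  refine (MeasurableEquiv.toLp 2 (Fin n → ℝ)).measurable.comp (measurable_pi_iff.2 fun j => ?_)
  simp only [Matrix.mulVec, dotProduct]
  refine Finset.measurable_fun_sum _ fun k _ => ((hB j k).comp measurable_fst).mul ?_
  exact ((EuclideanSpace.proj k : Rn n →L[ℝ] ℝ).continuous.measurable).comp measurable_snd

lemma quasiMeasurePreserving_act_prod {B : Rn n → Matrix (Fin n) (Fin n) ℝ}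
    (hB : ∀ j k, Measurable fun t => B t j k) (hinv : ∀ t, IsUnit (B t)) :
    Measure.QuasiMeasurePreserving (fun z : Rn n × Rn n => act (B z.1) z.2)
      ((volume : Measure (Rn n)).prod volume) volume := by
  refine ⟨measurable_act hB, Measure.AbsolutelyContinuous.mk fun s hs h0 => ?_⟩
  rw [Measure.map_apply (measurable_act hB) hs,
    Measure.measure_prod_null (measurable_act hB hs)]
  refine ae_of_all _ fun t => ?_
  change volume (act (B t) ⁻¹' s) = 0
  rw [addHaar_preimage_act (hinv t), h0, mul_zero]

/-- The integrand is jointly measurable: where `Φ` does not vanish the matrices may be replaced by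
measurable functions with invertible values, for which composition preserves null sets. -/
lemma aestronglyMeasurable_commutatorIntegrand {Φ : Rn n → ℝ} (hΦ : AEMeasurable Φ volume)
    {A : Fin m → Rn n → Matrix (Fin n) (Fin n) ℝ}
    (hA : ∀ i j k, AEMeasurable (fun t => A i t j k) volume)
    (hinv : ∀ i, ∀ᵐ t ∂(volume : Measure (Rn n)), t ∈ Function.support Φ → IsUnit (A i t))
    {b f : Fin m → Rn n → ℂ} (hb : ∀ i, Continuous (b i))
    (hf : ∀ i, AEStronglyMeasurable (f i) volume) :
    AEStronglyMeasurable (fun z : Rn n × Rn n => commutatorIntegrand Φ A b f z.2 z.1)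
      ((volume : Measure (Rn n)).prod volume) := by
  classical
  set A' : Fin m → Rn n → Matrix (Fin n) (Fin n) ℝ := fun i t =>
    Matrix.of fun j k => (hA i j k).mk _ t with hA'
  have hA'm : ∀ i j k, Measurable fun t => A' i t j k := fun i j k => (hA i j k).measurable_mk
  have hA'A : ∀ i, ∀ᵐ t ∂(volume : Measure (Rn n)), A i t = A' i t := by
    intro i
    have : ∀ᵐ t ∂(volume : Measure (Rn n)), ∀ j k, A i t j k = (hA i j k).mk _ t :=
      ae_all_iff.2 fun j => ae_all_iff.2 fun k => (hA i j k).ae_eq_mk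
    filter_upwards [this] with t ht
    ext j k
    exact ht j k
  have hdet : ∀ i, Measurable fun t => (A' i t).det := by
    intro i
    simp only [Matrix.det_apply]
    exact Finset.measurable_fun_sum _ fun σ _ =>
      (Finset.measurable_fun_prod _ fun j _ => hA'm i _ _).const_smul _
  have hset : ∀ i, MeasurableSet {t | (A' i t).det = 0} := fun i =>
    hdet i (measurableSet_singleton 0)
  set B : Fin m → Rn n → Matrix (Fin n) (Fin n) ℝ := fun i t =>
    if (A' i t).det = 0 then 1 else A' i t with hB
  have hBm : ∀ i j k, Measurable fun t => B i t j k := by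
    intro i j k
    have : (fun t => B i t j k) = fun t => if (A' i t).det = 0
        then (1 : Matrix (Fin n) (Fin n) ℝ) j k else A' i t j k := by
      ext t
      simp only [hB]
      split_ifs <;> rfl
    rw [this]
    exact Measurable.ite (hset i) measurable_const (hA'm i j k)
  have hBinv : ∀ i t, IsUnit (B i t) := by
    intro i t
    simp only [hB]
    split_ifs with h
    · exact isUnit_one
    · exact (Matrix.isUnit_iff_isUnit_det _).2 (isUnit_iff_ne_zero.2 h)
  have hmain : AEStronglyMeasurable
      (fun z : Rn n × Rn n => commutatorIntegrand Φ B b f z.2 z.1)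
      ((volume : Measure (Rn n)).prod volume) := by
    unfold commutatorIntegrand
    have h1 : AEStronglyMeasurable (fun z : Rn n × Rn n => ((Φ z.1 / ‖z.1‖ ^ n : ℝ) : ℂ))
        ((volume : Measure (Rn n)).prod volume) := by
      have : AEMeasurable (fun t : Rn n => Φ t / ‖t‖ ^ n) volume :=
        hΦ.div (measurable_norm.pow_const n).aemeasurable
      exact (Complex.measurable_ofReal.comp_aemeasurable
        (this.comp_quasiMeasurePreserving Measure.quasiMeasurePreserving_fst)).aestronglyMeasurable
    refine (h1.mul ?_).mul ?_
    · exact Finset.aestronglyMeasurable_fun_prod _ fun i _ =>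
        (hf i).comp_quasiMeasurePreserving (quasiMeasurePreserving_act_prod (hBm i) (hBinv i))
    · refine Finset.aestronglyMeasurable_fun_prod _ fun i _ => ?_
      refine Measurable.aestronglyMeasurable ?_
      exact ((hb i).measurable.comp measurable_snd).sub
        ((hb i).measurable.comp (measurable_act (hBm i)))
  refine hmain.congr ?_
  have hae : ∀ᵐ t ∂(volume : Measure (Rn n)),
      ∀ i, A i t = A' i t ∧ (t ∈ Function.support Φ → IsUnit (A i t)) :=
    ae_all_iff.2 fun i => (hA'A i).and (hinv i)
  filter_upwards [Measure.quasiMeasurePreserving_fst.ae hae] with z hz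
  by_cases h0 : Φ z.1 = 0
  · simp [commutatorIntegrand, h0]
  · have hBA : ∀ i, B i z.1 = A i z.1 := by
      intro i
      have hu := (hz i).2 h0
      rw [(hz i).1, Matrix.isUnit_iff_isUnit_det, isUnit_iff_ne_zero] at hu
      simp only [hB, if_neg hu, (hz i).1]
    simp only [commutatorIntegrand, hBA]

end Measurability

/-! ### Morrey–Herz norms and local integrability from bounds on the annuli -/

section Assembly

variable {n m : ℕ}

/-- The greatest integer in the definition of `thetaStar` is attained. -/
lemma matNorm_mul_lt_thetaStar (hn : 1 ≤ n) (hm : 1 ≤ m) {M : Fin m → Matrix (Fin n) (Fin n) ℝ}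
    (hM : ∀ i, IsUnit (M i)) (i : Fin m) :
    matNorm (M i) * matNorm (M i)⁻¹ < (2 : ℝ) ^ (-thetaStar M) := by
  set c : Fin m → ℝ := fun i => matNorm (M i) * matNorm (M i)⁻¹ with hc
  have hc0 : ∀ i, 0 < c i := fun i => mul_pos (matNorm_pos hn (hM i))
    (matNorm_pos hn (isUnit_inv (hM i)))
  have hmem : thetaStar M ∈ {θ : ℤ | ∀ i, c i < (2 : ℝ) ^ (-θ)} := by
    refine Int.csSup_mem ?_ ?_
    · obtain ⟨N, hN⟩ := pow_unbounded_of_one_lt (∑ i, c i) one_lt_two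
      refine ⟨-(N : ℤ), fun i => ?_⟩
      rw [neg_neg, zpow_natCast]
      exact (Finset.single_le_sum (fun j _ => (hc0 j).le) (Finset.mem_univ i)).trans_lt hN
    · let i₀ : Fin m := ⟨0, hm⟩
      obtain ⟨N, hN⟩ := exists_pow_lt_of_lt_one (hc0 i₀) (by norm_num : (1 / 2 : ℝ) < 1)
      refine ⟨N, fun θ hθ => ?_⟩
      have h1 := hN.trans (hθ i₀)
      rw [one_div, inv_pow, ← zpow_natCast, ← zpow_neg] at h1
      have := (zpow_lt_zpow_iff_right₀ one_lt_two).1 h1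
      lia
  exact hmem i

/-- Geometric growth of the norms on the annuli bounds the Morrey–Herz norm, with a constant given
by a geometric series. -/
lemma morreyHerzNorm_le_of_forall {q α ω : Rn n → ℝ} {f : Rn n → ℂ} {lam p : ℝ} {B : ℝ≥0∞}
    (hp : 0 < p)
    (h : ∀ k : ℤ, lpVarNormW (fun x => ENNReal.ofReal (q x)) ω
        (fun x => (((2 : ℝ) ^ ((k : ℝ) * α x) : ℝ) : ℂ) * (annulus n k).indicator f x) ≤
      ENNReal.ofReal ((2 : ℝ) ^ ((k : ℝ) * lam)) * B) :
    morreyHerzNorm α lam p q ω f ≤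
      ((1 - ENNReal.ofReal ((2 : ℝ) ^ (-(lam * p))))⁻¹) ^ (1 / p) * B := by
  refine iSup_le fun k₀ => ?_
  let e : ℕ ≃ Set.Iic k₀ :=
    { toFun := fun j => ⟨k₀ - j, by simp⟩
      invFun := fun k => (k₀ - k.1).toNat
      left_inv := fun j => by simp
      right_inv := fun k => by
        have := k.2
        rw [Set.mem_Iic] at this
        ext
        simp only
        lia }
  set x : ℝ≥0∞ := ENNReal.ofReal ((2 : ℝ) ^ ((k₀ : ℝ) * lam)) * B with hx
  have hsum : (∑' k : Set.Iic k₀, lpVarNormW (fun x => ENNReal.ofReal (q x)) ω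
        (fun x => (((2 : ℝ) ^ ((k.1 : ℝ) * α x) : ℝ) : ℂ) * (annulus n k.1).indicator f x) ^ p) ≤
      (1 - ENNReal.ofReal ((2 : ℝ) ^ (-(lam * p))))⁻¹ * x ^ p := by
    rw [← e.tsum_eq, ← ENNReal.tsum_geometric, ← ENNReal.tsum_mul_right]
    refine ENNReal.tsum_le_tsum fun j => ?_
    refine (ENNReal.rpow_le_rpow (h _) hp.le).trans (le_of_eq ?_)
    have h1 : ENNReal.ofReal ((2 : ℝ) ^ ((((e j).1 : ℤ) : ℝ) * lam)) * B =
        ENNReal.ofReal ((2 : ℝ) ^ (-(lam * j))) * x := by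
      rw [hx, ← mul_assoc, ← ENNReal.ofReal_mul (by positivity), ← Real.rpow_add two_pos]
      congr 3
      change ((k₀ - (j : ℤ) : ℤ) : ℝ) * lam = _
      push_cast
      ring
    rw [h1, ENNReal.mul_rpow_of_nonneg _ _ hp.le, ENNReal.ofReal_rpow_of_pos (by positivity),
      ← Real.rpow_mul two_pos.le, ← ENNReal.ofReal_pow (by positivity), ← Real.rpow_mul_natCast
      two_pos.le]
    ring_nf
  have hcancel : ENNReal.ofReal ((2 : ℝ) ^ (-(k₀ : ℝ) * lam)) *
      ENNReal.ofReal ((2 : ℝ) ^ ((k₀ : ℝ) * lam)) = 1 := by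
    rw [← ENNReal.ofReal_mul (by positivity), ← Real.rpow_add two_pos]
    simp
  calc _ ≤ ENNReal.ofReal ((2 : ℝ) ^ (-(k₀ : ℝ) * lam)) *
        ((1 - ENNReal.ofReal ((2 : ℝ) ^ (-(lam * p))))⁻¹ * x ^ p) ^ (1 / p) := by gcongr
    _ = ENNReal.ofReal ((2 : ℝ) ^ (-(k₀ : ℝ) * lam)) *
        ENNReal.ofReal ((2 : ℝ) ^ ((k₀ : ℝ) * lam)) *
          (((1 - ENNReal.ofReal ((2 : ℝ) ^ (-(lam * p))))⁻¹) ^ (1 / p) * B) := by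
        rw [ENNReal.mul_rpow_of_nonneg _ _ (by positivity), ← ENNReal.rpow_mul,
          mul_one_div_cancel hp.ne', ENNReal.rpow_one, hx]
        ring
    _ = _ := by rw [hcancel, one_mul]

/-- A function with finite weighted norm on every annulus is locally in `L^{q(·)}` away from the
origin, if the weight is bounded below on each annulus. -/
lemma memLpVarLocPunctured_of_annulus {q : Rn n → ℝ} (hq : ∀ x, 1 < q x)
    (hqm : AEMeasurable q volume) {f : Rn n → ℂ} (hf : AEStronglyMeasurable f volume)
    {w : ℤ → Rn n → ℝ} (hw : ∀ k, ∃ c > 0, ∀ x ∈ annulus n k, c ≤ w k x)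
    (hfin : ∀ k, luxNorm volume q (fun x => (annulus n k).indicator
      (fun x => ENNReal.ofReal (w k x) * ‖f x‖ₑ) x) ≠ ⊤) :
    MemLpVarLocPunctured (fun x => ENNReal.ofReal (q x)) f := by
  have hq0 : ∀ x, 0 < q x := fun x => by linarith [hq x]
  refine ⟨hf, fun S hS hS0 => ?_⟩
  rw [lpVarNorm_eq_luxNorm hq0]
  obtain ⟨ε, hε, hεS⟩ := Metric.mem_nhds_iff.1 (hS.isClosed.isOpen_compl.mem_nhds hS0)
  obtain ⟨R, hR0, hR⟩ := hS.isBounded.exists_pos_norm_le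
  obtain ⟨k₁, hk₁, -⟩ := exists_rpow_two_bounds hε
  obtain ⟨k₂, -, hk₂⟩ := exists_rpow_two_bounds hR0
  set g : ℤ → Rn n → ℝ≥0∞ := fun k x => (annulus n k).indicator (fun x => ‖f x‖ₑ) x with hg
  have hgm : ∀ k, AEMeasurable (g k) volume := fun k =>
    hf.enorm.indicator (measurableSet_annulus k)
  have hgfin : ∀ k, luxNorm volume q (g k) < ⊤ := by
    intro k
    obtain ⟨c, hc, hcw⟩ := hw k
    have hpt : ∀ x, g k x ≤ ENNReal.ofReal c⁻¹ * (annulus n k).indicator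
        (fun x => ENNReal.ofReal (w k x) * ‖f x‖ₑ) x := by
      intro x
      by_cases hx : x ∈ annulus n k
      · simp only [hg]
        rw [Set.indicator_of_mem hx, Set.indicator_of_mem hx, ← mul_assoc,
          ← ENNReal.ofReal_mul (by positivity)]
        refine le_mul_of_one_le_left' ?_
        rw [ENNReal.one_le_ofReal, inv_mul_eq_div, one_le_div hc]
        exact hcw x hx
      · simp [hg, Set.indicator_of_notMem hx]
    refine ((luxNorm_mono_ae (fun x => (hq0 x).le) (ae_of_all _ hpt)).trans
      (luxNorm_const_mul_le hq0 ENNReal.ofReal_ne_top)).trans_lt ?_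
    exact ENNReal.mul_lt_top ENNReal.ofReal_lt_top (hfin k).lt_top
  have hcover : ∀ x, ‖S.indicator f x‖ₑ ≤ ∑ k ∈ Finset.Icc k₁ k₂, g k x := by
    intro x
    by_cases hx : x ∈ S
    · have hx0 : x ≠ 0 := fun h => hS0 (h ▸ hx)
      obtain ⟨k, hk⟩ := exists_mem_annulus hx0
      obtain ⟨h1, h2⟩ := mem_annulus_iff.1 hk
      have hεx : ε ≤ ‖x‖ := by
        by_contra hcon
        exact hεS (by simpa using hcon) hx
      have hkk₁ : k₁ ≤ k := by
        have := hk₁.trans_le (hεx.trans h2)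
        rw [Real.rpow_lt_rpow_left_iff one_lt_two] at this
        have : k₁ - 1 < k := by exact_mod_cast this
        lia
      have hkk₂ : k ≤ k₂ := by
        have := h1.trans_le ((hR x hx).trans hk₂)
        rw [Real.rpow_lt_rpow_left_iff one_lt_two] at this
        have : k - 1 < k₂ := by exact_mod_cast this
        lia
      refine le_trans (le_of_eq ?_) (Finset.single_le_sum (f := fun k => g k x)
        (fun _ _ => zero_le) (Finset.mem_Icc.2 ⟨hkk₁, hkk₂⟩))
      simp only [hg]
      rw [Set.indicator_of_mem hx, Set.indicator_of_mem hk]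
    · simp [Set.indicator_of_notMem hx]
  refine ((luxNorm_mono_ae (fun x => (hq0 x).le) (ae_of_all _ hcover)).trans
    (luxNorm_sum_le _ hq hqm hgm)).trans_lt ?_
  exact ENNReal.sum_lt_top.2 fun k _ => hgfin k

/-- The weight of the target space is bounded below on each annulus. -/
lemma exists_target_weight_ge {α : Rn n → ℝ} {αinf : ℝ} (h0 : LogHolderAtZero α)
    (hinf : LogHolderAtInfty α αinf) {γ : Fin m → ℝ} {r : Fin m → Rn n → ℝ≥0∞}
    (hr : ∀ i x, 1 ≤ r i x) (k : ℤ) :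
    ∃ c > 0, ∀ x ∈ annulus n k, c ≤ (2 : ℝ) ^ ((k : ℝ) * α x) * ‖x‖ ^ targetGamma γ r x := by
  obtain ⟨K, -, hK⟩ := exists_abs_mul_sub_dyadicValue_le h0 hinf
  set G : ℝ := ∑ i, |γ i| + ∑ i, |γ i| with hG
  have hγ : ∀ x, |targetGamma γ r x| ≤ G := by
    intro x
    refine (abs_add_le _ _).trans (add_le_add (Finset.abs_sum_le_sum_abs _ _) ?_)
    refine (Finset.abs_sum_le_sum_abs _ _).trans (Finset.sum_le_sum fun i _ => ?_)
    rw [abs_mul, abs_of_nonneg (recip_nonneg _)]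
    exact mul_le_of_le_one_right (abs_nonneg _) (recip_le_one (hr i x))
  refine ⟨(2 : ℝ) ^ ((k : ℝ) * dyadicValue (α 0) αinf k - K) *
    ((2 : ℝ) ^ (-G) * (2 : ℝ) ^ (-(|(k : ℝ)| * G))), by positivity, fun x hx => ?_⟩
  obtain ⟨hx1, hx2⟩ := mem_annulus_iff.1 hx
  refine mul_le_mul ?_ ?_ (by positivity) (by positivity)
  · refine Real.rpow_le_rpow_of_exponent_le one_le_two ?_
    have := (abs_le.1 (hK k x hx)).1
    rw [mul_sub] at this
    linarith
  · have h1 := (rpow_two_mul_le hx1.le hx2 (targetGamma γ r x)).1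
    set g := targetGamma γ r x with hg
    have h2 : (2 : ℝ) ^ (-|g|) * (2 : ℝ) ^ ((k : ℝ) * g) ≤ ‖x‖ ^ g := by
      rw [Real.rpow_neg two_pos.le, inv_mul_le_iff₀ (by positivity)]
      exact h1
    refine le_trans (mul_le_mul ?_ ?_ (by positivity) (by positivity)) h2
    · exact Real.rpow_le_rpow_of_exponent_le one_le_two (by linarith [hγ x])
    · refine Real.rpow_le_rpow_of_exponent_le one_le_two ?_
      have h3 : |(k : ℝ) * g| ≤ |(k : ℝ)| * G := by
        rw [abs_mul]
        exact mul_le_mul_of_nonneg_left (hγ x) (abs_nonneg _)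
      linarith [(abs_le.1 h3).1]

end Assembly

/-! ### Integration over the parameter -/

section Integration

variable {n m : ℕ}

/-- Minkowski's inequality transfers bounds for almost every fixed `t` to the integral over `t`. -/
lemma luxNorm_annulus_lintegral_le {q : Rn n → ℝ} (hq : ∀ x, 1 < q x) (hqm : AEMeasurable q volume)
    {k : ℤ} {w : Rn n → ℝ} (hw : AEMeasurable w volume) {F : Rn n → Rn n → ℂ}
    (hF : AEStronglyMeasurable (fun z : Rn n × Rn n => F z.2 z.1)
      ((volume : Measure (Rn n)).prod volume))
    {B : ℝ≥0∞} (hB : B ≠ ⊤) {g : Rn n → ℝ≥0∞}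
    (h : ∀ᵐ t ∂(volume : Measure (Rn n)), luxNorm volume q (fun x => (annulus n k).indicator
      (fun x => ENNReal.ofReal (w x) * ‖F x t‖ₑ) x) ≤ B * g t) :
    luxNorm volume q (fun x => (annulus n k).indicator
      (fun x => ENNReal.ofReal (w x) * ∫⁻ t, ‖F x t‖ₑ) x) ≤ B * ∫⁻ t, g t := by
  have e : (fun x => (annulus n k).indicator
      (fun x => ENNReal.ofReal (w x) * ∫⁻ t, ‖F x t‖ₑ) x) =
      fun x => ∫⁻ t, (annulus n k).indicator
        (fun x => ENNReal.ofReal (w x) * ‖F x t‖ₑ) x := by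
    ext x
    by_cases hx : x ∈ annulus n k
    · simp only [Set.indicator_of_mem hx]
      rw [lintegral_const_mul' _ _ ENNReal.ofReal_ne_top]
    · simp [Set.indicator_of_notMem hx]
  rw [e, ← lintegral_const_mul' _ _ hB]
  refine (luxNorm_lintegral_le hq hqm (F := fun t x => (annulus n k).indicator
        (fun x => ENNReal.ofReal (w x) * ‖F x t‖ₑ) x) ?_).trans (lintegral_mono_ae h)
  have h1 : AEMeasurable (fun z : Rn n × Rn n => ENNReal.ofReal (w z.2) * ‖F z.2 z.1‖ₑ)
      ((volume : Measure (Rn n)).prod volume) :=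
    (hw.comp_quasiMeasurePreserving Measure.quasiMeasurePreserving_snd).ennreal_ofReal.mul hF.enorm
  exact h1.indicator (measurable_snd (measurableSet_annulus k))

/-- Finite weighted norms on all annuli make the integral over `t` absolutely convergent at almost
every point. -/
lemma ae_integrable_of_annulus (hn : 1 ≤ n) {q : Rn n → ℝ} (hq : ∀ x, 1 < q x)
    (hqm : AEMeasurable q volume) {w : ℤ → Rn n → ℝ} (hwm : ∀ k, AEMeasurable (w k) volume)
    (hw : ∀ k, ∀ x ∈ annulus n k, 0 < w k x) {F : Rn n → Rn n → ℂ}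
    (hF : AEStronglyMeasurable (fun z : Rn n × Rn n => F z.2 z.1)
      ((volume : Measure (Rn n)).prod volume))
    (hfin : ∀ k, luxNorm volume q (fun x => (annulus n k).indicator
      (fun x => ENNReal.ofReal (w k x) * ∫⁻ t, ‖F x t‖ₑ) x) < ⊤) :
    ∀ᵐ x ∂(volume : Measure (Rn n)), Integrable (fun t => F x t) volume := by
  have : Nonempty (Fin n) := ⟨⟨0, hn⟩⟩
  have hI : AEMeasurable (fun x => ∫⁻ t, ‖F x t‖ₑ) volume := hF.enorm.lintegral_prod_left'
  have hlt : ∀ᵐ x ∂(volume : Measure (Rn n)), ∀ k, (annulus n k).indicator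
      (fun x => ENNReal.ofReal (w k x) * ∫⁻ t, ‖F x t‖ₑ) x < ⊤ :=
    ae_all_iff.2 fun k => ae_lt_top_of_luxNorm_lt_top (fun x => by linarith [hq x]) hqm
      (((hwm k).ennreal_ofReal.mul hI).indicator (measurableSet_annulus k)) (hfin k)
  have h0 : ∀ᵐ x ∂(volume : Measure (Rn n)), x ≠ 0 :=
    compl_mem_ae_iff.2 (measure_singleton 0)
  filter_upwards [hlt, h0, hF.prod_swap.prodMk_left] with x hx hx0 hxm
  refine ⟨hxm, ?_⟩
  obtain ⟨k, hk⟩ := exists_mem_annulus hx0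
  have h1 := hx k
  rw [Set.indicator_of_mem hk] at h1
  exact ENNReal.lt_top_of_mul_ne_top_right h1.ne (by simpa using hw k x hk)

end Integration

end HausdorffCommutator

/-! ### Boundedness of the commutator -/

theorem mainTheorem1 {n m : ℕ} (hn : 1 ≤ n) (hm : 1 ≤ m)
    (Φ : Rn n → ℝ) (hΦ_nonneg : ∀ t, 0 ≤ Φ t) (hΦ_meas : AEMeasurable Φ volume)
    (A : Fin m → Rn n → Matrix (Fin n) (Fin n) ℝ)
    (hA_meas : ∀ i j k, AEMeasurable (fun t => A i t j k) volume)
    (hA_inv : ∀ i, ∀ᵐ t ∂(volume : Measure (Rn n)), t ∈ Function.support Φ → IsUnit (A i t))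
    (γ lam p : Fin m → ℝ) (p₀ ζ : ℝ) (β : Fin m → ℝ≥0)
    (hlam : ∀ i, 0 < lam i) (hp : ∀ i, 0 < p i) (hp₀ : 0 < p₀) (hζ : 0 < ζ)
    (hβ : ∀ i, 0 < β i ∧ β i ≤ 1)
    (q : Fin m → Rn n → ℝ) (hq : ∀ i, ClassPb (q i))
    (r : Fin m → Rn n → ℝ≥0∞) (rinf : Fin m → ℝ≥0∞) (hr : ∀ i, ClassPinfty (r i) (rinf i))
    (α : Fin m → Rn n → ℝ) (αinf : Fin m → ℝ)
    (hα_bdd : ∀ i, MemLp (α i) ⊤ volume) (hα_zero : ∀ i, LogHolderAtZero (α i))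
    (hα_inf : ∀ i, LogHolderAtInfty (α i) (αinf i))
    (hq_target : ClassPb (targetExponent q r))
    (hαs_bdd : MemLp (targetAlpha α β γ r) ⊤ volume)
    (hαs_zero : LogHolderAtZero (targetAlpha α β γ r))
    (hαs_inf : ∃ a : ℝ, LogHolderAtInfty (targetAlpha α β γ r) a)
    (b : Fin m → Rn n → ℂ) (hb : ∀ i, MemHolder (β i) (b i))
    (hembed : ∀ i, ∀ᵐ t ∂(volume : Measure (Rn n)), t ∈ Function.support Φ →
      (∀ᵐ x ∂(volume : Measure (Rn n)), q i (act (A i t)⁻¹ x) ≤ ζ * q i x) ∧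
        thetaNorm ζ (q i) (A i t) < ⊤)
    (hα_sign : ∀ i, 0 ≤ α i 0 - αinf i)
    (hcases :
      (∀ i, -(n : ℝ) < γ i ∧ r i 0 = essSup (r i) volume ∧ rinf i = essInf (r i) volume) ∨
      (∀ i, γ i < -(n : ℝ) ∧ r i 0 = essInf (r i) volume ∧ rinf i = essSup (r i) volume) ∨
      (∀ i, γ i = -(n : ℝ)))
    (hC1 : constC1 Φ A ζ q γ β lam α αinf < ⊤) :
    ∃ C : ℝ≥0, ∀ f : Fin m → Rn n → ℂ,
      (∀ i, MemMorreyHerz (α i) (lam i) (p i) (fun x => ζ * q i x)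
        (fun x => ‖x‖ ^ (γ i)) (f i)) →
      (∀ᵐ x ∂(volume : Measure (Rn n)),
        Integrable (fun t => commutatorIntegrand Φ A b f x t) volume) ∧
      MemMorreyHerz (targetAlpha α β γ r) (∑ i, lam i) p₀ (fun x => ζ * targetExponent q r x)
        (fun x => ‖x‖ ^ (targetGamma γ r x)) (commutator Φ A b f) ∧
      morreyHerzNorm (targetAlpha α β γ r) (∑ i, lam i) p₀
          (fun x => ζ * targetExponent q r x)
          (fun x => ‖x‖ ^ (targetGamma γ r x)) (commutator Φ A b f) ≤
        C * ∏ i, morreyHerzNorm (α i) (lam i) (p i) (fun x => ζ * q i x)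
          (fun x => ‖x‖ ^ (γ i)) (f i) := by
  have hn' : Nonempty (Fin n) := ⟨⟨0, hn⟩⟩
  have hr1 : ∀ i x, 1 ≤ r i x := fun i => (hr i).2.1
  have hqt := hq_target.one_lt
  have hA_ae : ∀ᵐ t ∂(volume : Measure (Rn n)), t ∈ Function.support Φ → ∀ i, IsUnit (A i t) := by
    filter_upwards [ae_all_iff.2 hA_inv] with t ht hts i using ht i hts
  have hembed_ae : ∀ᵐ t ∂(volume : Measure (Rn n)), t ∈ Function.support Φ → ∀ i,
      (∀ᵐ x ∂(volume : Measure (Rn n)), q i (act (A i t)⁻¹ x) ≤ ζ * q i x) ∧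
        thetaNorm ζ (q i) (A i t) < ⊤ := by
    filter_upwards [ae_all_iff.2 hembed] with t ht hts i using ht i hts
  by_cases hΦ0 : ∀ᵐ t ∂(volume : Measure (Rn n)), Φ t = 0
  · -- The operator is zero when `Φ` vanishes almost everywhere.
    have hzero : ∀ (f : Fin m → Rn n → ℂ) (x : Rn n),
        (fun t => commutatorIntegrand Φ A b f x t) =ᵐ[volume] fun _ => 0 := by
      intro f x
      filter_upwards [hΦ0] with t ht
      simp [commutatorIntegrand, ht]
    have hcomm : ∀ f : Fin m → Rn n → ℂ, commutator Φ A b f = fun _ => 0 := by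
      intro f
      ext x
      rw [HausdorffCommutator.commutator, integral_congr_ae (hzero f x), integral_zero]
    have hq0 : ∀ x, 0 < ζ * targetExponent q r x := fun x =>
      mul_pos hζ (by linarith [hqt x])
    have hlux : luxNorm (volume : Measure (Rn n)) (fun x => ζ * targetExponent q r x)
        (fun _ => 0) = 0 := luxNorm_zero hq0
    have hnorm : morreyHerzNorm (targetAlpha α β γ r) (∑ i, lam i) p₀
        (fun x => ζ * targetExponent q r x) (fun x => ‖x‖ ^ (targetGamma γ r x))
        (fun _ => 0) = 0 := by
      refine le_antisymm ((morreyHerzNorm_le_of_forall (B := 0) hp₀ fun k => ?_).trans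
        (mul_zero _).le) zero_le
      rw [lpVarNormW, lpVarNorm_eq_luxNorm hq0]
      simp [hlux]
    refine ⟨0, fun f _ => ⟨ae_of_all _ fun x => (integrable_zero _ _ _).congr (hzero f x).symm,
      ?_, ?_⟩⟩
    · rw [hcomm]
      refine ⟨⟨aestronglyMeasurable_const, fun S _ _ => ?_⟩, ?_⟩
      · rw [lpVarNorm_eq_luxNorm hq0]
        simp [hlux]
      · rw [hnorm]
        exact ENNReal.zero_lt_top
    · rw [hcomm, hnorm]
      exact zero_le
  -- Otherwise a single admissible matrix forces `ζ = 1`.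
  obtain rfl : ζ = 1 := by
    have hfreq : ∃ᵐ t ∂(volume : Measure (Rn n)), Φ t ≠ 0 := Filter.not_eventually.1 hΦ0
    obtain ⟨t, ht0, htA, hte⟩ := (hfreq.and_eventually (hA_ae.and hembed_ae)).exists
    obtain ⟨hle, hϑ⟩ := hte ht0 ⟨0, hm⟩
    exact eq_one_of_thetaNorm_lt_top hn (hq _) hζ (htA ht0 _) hle hϑ
  simp only [one_mul] at hembed_ae ⊢
  have hαm : ∀ i, AEMeasurable (α i) volume := fun i => (hα_bdd i).1.aemeasurable
  obtain ⟨C₀, hC₀⟩ := exists_luxNorm_commutatorIntegrand_le (lam := lam) hn hp hq hr1 hqt hαm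
    hα_zero hα_inf hα_sign hb Φ A
  set C₁ := constC1 Φ A 1 q γ β lam α αinf with hC₁
  set G : ℝ≥0∞ :=
    ((1 - ENNReal.ofReal ((2 : ℝ) ^ (-((∑ i, lam i) * p₀))))⁻¹) ^ (1 / p₀) with hG
  have hlam_pos : 0 < ∑ i, lam i :=
    Finset.sum_pos (fun i _ => hlam i) ⟨⟨0, hm⟩, Finset.mem_univ _⟩
  have hGtop : G ≠ ⊤ := by
    refine ENNReal.rpow_ne_top_of_nonneg (by positivity) (ENNReal.inv_ne_top.2 ?_)
    refine (tsub_pos_of_lt ?_).ne'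
    rw [ENNReal.ofReal_lt_one]
    exact Real.rpow_lt_one_of_one_lt_of_neg one_lt_two (by nlinarith)
  have hCtop : G * (C₀ * C₁) ≠ ⊤ :=
    ENNReal.mul_ne_top hGtop (ENNReal.mul_ne_top ENNReal.coe_ne_top hC1.ne)
  refine ⟨(G * (C₀ * C₁)).toNNReal, fun f hf => ?_⟩
  rw [ENNReal.coe_toNNReal hCtop]
  have hfm : ∀ i, AEStronglyMeasurable (f i) volume := fun i => (hf i).1.1
  have hMH : ∀ i, morreyHerzNorm (α i) (lam i) (p i) (q i) (fun x => ‖x‖ ^ γ i) (f i) ≠ ⊤ :=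
    fun i => (hf i).2.ne
  set P := ∏ i, morreyHerzNorm (α i) (lam i) (p i) (q i) (fun x => ‖x‖ ^ γ i) (f i) with hP
  have hPtop : P ≠ ⊤ := ENNReal.prod_ne_top fun i _ => hMH i
  have hb_cont : ∀ i, Continuous (b i) := fun i => by
    obtain ⟨L, hL⟩ := hb i
    exact hL.continuous (hβ i).1
  have hjoint := aestronglyMeasurable_commutatorIntegrand hΦ_meas hA_meas hA_inv hb_cont hfm
  set w : ℤ → Rn n → ℝ := fun k x =>
    (2 : ℝ) ^ ((k : ℝ) * targetAlpha α β γ r x) * ‖x‖ ^ targetGamma γ r x with hw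
  have hγm : AEMeasurable (targetGamma γ r) volume := by
    refine aemeasurable_const.add (Finset.aemeasurable_fun_sum _ fun i _ => ?_)
    exact (hr i).1.inv.ennreal_toReal.const_mul _
  have hwm : ∀ k, AEMeasurable (w k) volume := by
    intro k
    have h1 : AEMeasurable (fun x => (2 : ℝ) ^ ((k : ℝ) * targetAlpha α β γ r x)) volume :=
      aemeasurable_const.pow (hαs_bdd.1.aemeasurable.const_mul _)
    exact h1.mul (measurable_norm.aemeasurable.pow hγm)
  have hbound : ∀ k : ℤ, luxNorm volume (targetExponent q r) (fun x =>
      (annulus n k).indicator (fun x =>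
        ENNReal.ofReal (w k x) * ∫⁻ t, ‖commutatorIntegrand Φ A b f x t‖ₑ) x) ≤
      ENNReal.ofReal ((2 : ℝ) ^ ((k : ℝ) * ∑ i, lam i)) * (C₀ * C₁ * P) := by
    intro k
    have e : ENNReal.ofReal ((2 : ℝ) ^ ((k : ℝ) * ∑ i, lam i)) * (C₀ * C₁ * P) =
        C₀ * ENNReal.ofReal ((2 : ℝ) ^ ((k : ℝ) * ∑ i, lam i)) * P * C₁ := by ring
    rw [e]
    refine luxNorm_annulus_lintegral_le hqt hq_target.1 (hwm k) hjoint
      (ENNReal.mul_ne_top (ENNReal.mul_ne_top ENNReal.coe_ne_top ENNReal.ofReal_ne_top) hPtop) ?_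
    filter_upwards [hA_ae, hembed_ae] with t htA hte
    by_cases hts : Φ t = 0
    · refine le_of_eq_of_le ?_ zero_le
      rw [← luxNorm_zero (ν := volume) (q := targetExponent q r) fun x => by linarith [hqt x]]
      congr 1
      ext x
      simp [commutatorIntegrand, hts]
    · exact hC₀ f hfm hMH k t _ (hΦ_nonneg t) (htA hts)
        (matNorm_mul_lt_thetaStar hn hm (htA hts)) (fun i => (hte hts i).1)
        fun i => (hte hts i).2.ne
  have hboundtop : ∀ k : ℤ, ENNReal.ofReal ((2 : ℝ) ^ ((k : ℝ) * ∑ i, lam i)) *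
      (C₀ * C₁ * P) < ⊤ := fun k => (ENNReal.mul_ne_top ENNReal.ofReal_ne_top
        (ENNReal.mul_ne_top (ENNReal.mul_ne_top ENNReal.coe_ne_top hC1.ne) hPtop)).lt_top
  have hcomm : ∀ k : ℤ, luxNorm volume (targetExponent q r) (fun x =>
      (annulus n k).indicator (fun x =>
        ENNReal.ofReal (w k x) * ‖commutator Φ A b f x‖ₑ) x) ≤
      ENNReal.ofReal ((2 : ℝ) ^ ((k : ℝ) * ∑ i, lam i)) * (C₀ * C₁ * P) := by
    intro k
    refine (luxNorm_mono_ae (fun x => by linarith [hqt x]) (ae_of_all _ fun x => ?_)).trans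
      (hbound k)
    refine Set.indicator_le_indicator ?_
    gcongr
    exact enorm_integral_le_lintegral_enorm _
  have hnorm : morreyHerzNorm (targetAlpha α β γ r) (∑ i, lam i) p₀ (targetExponent q r)
      (fun x => ‖x‖ ^ (targetGamma γ r x)) (commutator Φ A b f) ≤ G * (C₀ * C₁) * P := by
    refine (morreyHerzNorm_le_of_forall (B := C₀ * C₁ * P) hp₀ fun k => ?_).trans (by
      rw [← mul_assoc])
    rw [lpVarNormW_annulus (fun x => by linarith [hqt x]) _ fun x => by positivity]
    exact hcomm k
  obtain ⟨a, ha⟩ := hαs_inf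
  refine ⟨ae_integrable_of_annulus hn hqt hq_target.1 hwm (fun k x hx => ?_) hjoint
    fun k => (hbound k).trans_lt (hboundtop k), ⟨?_, ?_⟩, hnorm⟩
  · have := norm_pos_of_mem_annulus hx
    positivity
  · exact memLpVarLocPunctured_of_annulus hqt hq_target.1
      hjoint.prod_swap.integral_prod_right' (exists_target_weight_ge hαs_zero ha hr1)
      fun k => ((hcomm k).trans_lt (hboundtop k)).ne
  · exact hnorm.trans_lt (ENNReal.mul_lt_top hCtop.lt_top hPtop.lt_top)
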